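/- Let $\mathbb{H},\mathbb{H}_\alpha,\Xi$ be real Hilbert spaces, where $\mathbb{H}_\alpha$ (with norm $|\cdot|_\alpha$ and inner product $(\cdot,\cdot)_\alpha$) is continuously and densely embedded in $\mathbb{H}$. Let $A$ be the generator of a $C_0$-semigroup $G(t)$, $t\ge 0$, in $\mathbb{H}$ with $\mathcal{D}(A)\subset\mathbb{H}_\alpha$, let $B\colon\Xi\to\mathbb{H}$ be a bounded linear operator, and let $$\mathcal{F}(v,\xi)=(\mathcal{F}_1v,v)_\alpha+2(\mathcal{F}_2v,\xi)_\Xi+(\mathcal{F}_3\xi,\xi)_\Xi,\qquad v\in\mathbb{H}_\alpha,\ \xi\in\Xi,$$ with bounded operators $\mathcal{F}_1=\mathcal{F}_1^*\in\mathcal{L}(\mathbb{H}_\alpha)$, $\mathcal{F}_2\in\mathcal{L}(\mathbb{H}_\alpha;\Xi)$, $\mathcal{F}_3=\mathcal{F}_3^*\in\mathcal{L}(\Xi)$. The superscript $\mathbb{C}$ denotes complexifications of spaces and operators, and $\mathcal{F}^{\mathbb{C}}(v_1+iv_2,\xi_1+i\xi_2):=\mathcal{F}(v_1,\xi_1)+\mathcal{F}(v_2,\xi_2)$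 is the Hermitian extension of $\mathcal{F}$. Suppose that $A$ (more precisely, its part in $\mathbb{H}_\alpha$) is also the generator of a $C_0$-semigroup in $\mathbb{H}_\alpha$, and that (RES) holds: $A^{\mathbb{C}}$ has no spectrum on the imaginary axis and the operators $(A^{\mathbb{C}}-i\omega I)^{-1}$ are bounded in the norm of $\mathcal{L}(\mathbb{H}^{\mathbb{C}};\mathbb{H}^{\mathbb{C}}_\alpha)$ uniformly in $\omega\in\mathbb{R}$. Then the following conditions are equivalent: 1. For some $\delta'>0$ we have $\mathcal{F}^{\mathbb{C}}\big(-(A^{\mathbb{C}}-i\omega I)^{-1}B^{\mathbb{C}}\xi,\xi\big)\le-\delta'|\xi|^2_{\Xi^{\mathbb{C}}}$ for all $\xi\in\Xi^{\mathbb{C}}$ and $\omega\in\mathbb{R}$. 2. There are $\delta>0$ and a self-adjoint $P\in\mathcal{L}(\mathbb{H}_\alpha)$ such that for $V(v):=(Pv,v)_\alpha$ and any $T\ge0$ $$V(v(T))-V(v_0)+\int_0^T\mathcal{F}(v(s),\xi(s))\,ds\le-\delta\int_0^T\big(|v(s)|_\alpha^2+|\xi(s)|_\Xi^2\big)\,ds,$$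 for all $v_0\in\mathbb{H}_\alpha$ and $\xi(\cdot)\in L_2(0,T;\Xi)$ such that the mild solution $v(t)=G(t)v_0+\int_0^tG(t-s)B\xi(s)\,ds$ of $\dot v=Av+B\xi$ satisfies $v(\cdot)\in C([0,T];\mathbb{H}_\alpha)$. Moreover, under condition 1 there are $\delta>0$ and a self-adjoint $\widetilde P\in\mathcal{L}(\mathbb{H}^{\mathbb{C}}_\alpha)$ satisfying the analogous inequality (with $\widetilde P$, $\mathcal{F}^{\mathbb{C}}$ and $V(v)=(\widetilde Pv,v)_{\mathbb{H}_\alpha^{\mathbb{C}}}$) along the mild solutions of the complexified system, that is, with $G(t)^{\mathbb{C}}$, $B^{\mathbb{C}}$, $v_0\in\mathbb{H}_\alpha^{\mathbb{C}}$, $\xi(\cdot)\in L_2(0,T;\Xi^{\mathbb{C}})$ and $v(\cdot)\in C([0,T];\mathbb{H}_\alpha^{\mathbb{C}})$. For every $\delta>0$ and every self-adjoint $\widetilde P$ that satisfy this complex inequality, the real block $P:=\widetilde P_{11}$, given by $\widetilde P_{11}x=\operatorname{Re}\widetilde P(x+i0)$, is self-adjoint in $\mathbb{H}_\alpha$ and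 satisfies the inequality of condition 2 with the same $\delta$. -/

import Mathlib

open MeasureTheory Set Filter Topology

noncomputable section

namespace FreqThm

/-! ### Complexification of a real Hilbert space -/

/-- The complexification of a real inner product space `E`: pairs `x + i y` with the norm
`‖x + i y‖² = ‖x‖² + ‖y‖²`, complex scalars, and the Hermitian inner product extending that of
`E` (conjugate linear in the first argument, as everywhere in Mathlib). -/
def Cx (E : Type*) : Type _ := WithLp 2 (E × E)

namespace Cx

section Basic

variable {E : Type*}

/-- Real part. -/
def re (z : Cx E) : E := (WithLp.ofLp (p := 2) (V := E × E) z).1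

/-- Imaginary part. -/
def im (z : Cx E) : E := (WithLp.ofLp (p := 2) (V := E × E) z).2

/-- The vector `x + i y`. -/
def mk (x y : E) : Cx E := WithLp.toLp 2 (x, y)

@[simp] lemma re_mk (x y : E) : (mk x y).re = x := rfl
@[simp] lemma im_mk (x y : E) : (mk x y).im = y := rfl

@[ext] lemma ext {z w : Cx E} (h₁ : z.re = w.re) (h₂ : z.im = w.im) : z = w := by
  have h : (WithLp.ofLp (p := 2) (V := E × E) z) = WithLp.ofLp (p := 2) (V := E × E) w :=
    Prod.ext h₁ h₂
  exact WithLp.ofLp_injective 2 h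

variable [NormedAddCommGroup E]

instance : NormedAddCommGroup (Cx E) :=
  inferInstanceAs (NormedAddCommGroup (WithLp 2 (E × E)))

instance [CompleteSpace E] : CompleteSpace (Cx E) :=
  inferInstanceAs (CompleteSpace (WithLp 2 (E × E)))

@[simp] lemma re_add (z w : Cx E) : (z + w).re = z.re + w.re := rfl
@[simp] lemma im_add (z w : Cx E) : (z + w).im = z.im + w.im := rfl
@[simp] lemma re_zero : (0 : Cx E).re = 0 := rfl
@[simp] lemma im_zero : (0 : Cx E).im = 0 := rfl

lemma norm_sq (z : Cx E) : ‖z‖ ^ 2 = ‖z.re‖ ^ 2 + ‖z.im‖ ^ 2 :=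
  WithLp.prod_norm_sq_eq_of_L2 (α := E) (β := E) z

end Basic

section Hilbert

variable {E : Type*} [NormedAddCommGroup E] [InnerProductSpace ℝ E]

/-- `(a + i b) (x + i y) = (a x - b y) + i (a y + b x)`. -/
instance : SMul ℂ (Cx E) :=
  ⟨fun c z => mk (c.re • z.re - c.im • z.im) (c.re • z.im + c.im • z.re)⟩

@[simp] lemma re_smul (c : ℂ) (z : Cx E) : (c • z).re = c.re • z.re - c.im • z.im := rfl
@[simp] lemma im_smul (c : ℂ) (z : Cx E) : (c • z).im = c.re • z.im + c.im • z.re := rfl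

instance : Module ℂ (Cx E) where
  one_smul z := by ext <;> simp
  mul_smul c d z := by
    ext
    · simp only [re_smul, im_smul, Complex.mul_re, Complex.mul_im]; module
    · simp only [re_smul, im_smul, Complex.mul_re, Complex.mul_im]; module
  smul_zero c := by ext <;> simp
  smul_add c z w := by
    ext
    · simp only [re_smul, re_add, im_add]; module
    · simp only [im_smul, re_add, im_add]; module
  add_smul c d z := by
    ext
    · simp only [re_smul, re_add, Complex.add_re, Complex.add_im]; module
    · simp only [im_smul, im_add, Complex.add_re, Complex.add_im]; module
  zero_smul z := by ext <;> simp

/-- `⟪x₁ + i x₂, y₁ + i y₂⟫ = (x₁, y₁) + (x₂, y₂) + i ((x₁, y₂) - (x₂, y₁))`. -/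
instance : Inner ℂ (Cx E) :=
  ⟨fun z w => ⟨inner ℝ z.re w.re + inner ℝ z.im w.im, inner ℝ z.re w.im - inner ℝ z.im w.re⟩⟩

lemma inner_def (z w : Cx E) : inner ℂ z w =
    (⟨inner ℝ z.re w.re + inner ℝ z.im w.im, inner ℝ z.re w.im - inner ℝ z.im w.re⟩ : ℂ) := rfl

lemma norm_smul_eq (c : ℂ) (z : Cx E) : ‖c • z‖ = ‖c‖ * ‖z‖ := by
  have h : ‖c • z‖ ^ 2 = (‖c‖ * ‖z‖) ^ 2 := by
    rw [mul_pow, norm_sq, norm_sq, Complex.sq_norm, Complex.normSq_apply, re_smul, im_smul,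
      norm_sub_sq_real, norm_add_sq_real]
    simp only [norm_smul, inner_smul_left, inner_smul_right, mul_pow, Real.norm_eq_abs, sq_abs,
      real_inner_comm z.re z.im]
    simp only [conj_trivial]
    ring
  exact (pow_left_inj₀ (norm_nonneg _) (by positivity) two_ne_zero).1 h

instance : InnerProductSpace ℂ (Cx E) where
  norm_smul_le c z := (norm_smul_eq c z).le
  norm_sq_eq_re_inner z := by
    rw [norm_sq, inner_def]
    simp
  conj_inner_symm z w := by
    apply Complex.ext
    · simp [inner_def, real_inner_comm]
    · simp [inner_def, real_inner_comm]
  add_left x y z := by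
    apply Complex.ext
    · simp [inner_def, inner_add_left]; ring
    · simp [inner_def, inner_add_left]; ring
  smul_left x y r := by
    apply Complex.ext
    · simp [inner_def, inner_add_left, inner_sub_left, inner_smul_left]; ring
    · simp [inner_def, inner_add_left, inner_sub_left, inner_smul_left]; ring

@[simp] lemma re_real_smul (c : ℝ) (z : Cx E) : (c • z).re = c • z.re := by
  rw [← Complex.coe_smul, re_smul]; simp

@[simp] lemma im_real_smul (c : ℝ) (z : Cx E) : (c • z).im = c • z.im := by
  rw [← Complex.coe_smul, im_smul]; simp

/-- The real part as a bounded real-linear operator. -/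
def reL : Cx E →L[ℝ] E :=
  LinearMap.mkContinuous
    { toFun := re
      map_add' := re_add
      map_smul' := fun c z => by simp } 1 (fun z => by
    have h := norm_sq z
    have h2 : ‖z.re‖ ^ 2 ≤ ‖z‖ ^ 2 := by rw [h]; nlinarith [sq_nonneg ‖z.im‖]
    simpa using (pow_le_pow_iff_left₀ (norm_nonneg _) (norm_nonneg _) two_ne_zero).1 h2)

/-- The embedding `x ↦ x + i 0` as a bounded real-linear operator. -/
def ofRealL : E →L[ℝ] Cx E :=
  LinearMap.mkContinuous
    { toFun := fun x => mk x 0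
      map_add' := fun x y => by ext <;> simp
      map_smul' := fun c x => by ext <;> simp } 1 (fun x => by
    have h := norm_sq (mk x 0)
    have h2 : ‖mk x 0‖ ^ 2 ≤ ‖x‖ ^ 2 := by rw [h]; simp
    simpa using (pow_le_pow_iff_left₀ (norm_nonneg _) (norm_nonneg _) two_ne_zero).1 h2)

end Hilbert

end Cx

section Operators

variable {E F : Type*} [NormedAddCommGroup E] [InnerProductSpace ℝ E]
  [NormedAddCommGroup F] [InnerProductSpace ℝ F]

/-- The complexification of a bounded operator, `T(x + i y) = T x + i T y`. -/
def complexify (T : E →L[ℝ] F) : Cx E →L[ℂ] Cx F :=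
  LinearMap.mkContinuous
    { toFun := fun z => Cx.mk (T z.re) (T z.im)
      map_add' := fun z w => by ext <;> simp
      map_smul' := fun c z => by ext <;> simp } ‖T‖ (fun z => by
    have h : ‖Cx.mk (T z.re) (T z.im)‖ ^ 2 ≤ (‖T‖ * ‖z‖) ^ 2 := by
      rw [mul_pow, Cx.norm_sq, Cx.norm_sq, Cx.re_mk, Cx.im_mk, mul_add, ← mul_pow, ← mul_pow]
      gcongr <;> exact T.le_opNorm _
    exact (pow_le_pow_iff_left₀ (norm_nonneg _) (by positivity) two_ne_zero).1 h)

/-- The complexification of an unbounded operator: its domain is `D(A) + i D(A)`. -/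
def complexifyPMap (A : E →ₗ.[ℝ] F) : Cx E →ₗ.[ℂ] Cx F where
  domain :=
    { carrier := {z | z.re ∈ A.domain ∧ z.im ∈ A.domain}
      add_mem' := fun {z w} hz hw =>
        ⟨A.domain.add_mem hz.1 hw.1, A.domain.add_mem hz.2 hw.2⟩
      zero_mem' := ⟨A.domain.zero_mem, A.domain.zero_mem⟩
      smul_mem' := fun c z hz =>
        ⟨A.domain.sub_mem (A.domain.smul_mem _ hz.1) (A.domain.smul_mem _ hz.2),
          A.domain.add_mem (A.domain.smul_mem _ hz.2) (A.domain.smul_mem _ hz.1)⟩ }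
  toFun :=
    { toFun := fun z => Cx.mk (A ⟨z.1.re, z.2.1⟩) (A ⟨z.1.im, z.2.2⟩)
      map_add' := fun z w => by
        ext
        · exact A.map_add ⟨z.1.re, z.2.1⟩ ⟨w.1.re, w.2.1⟩
        · exact A.map_add ⟨z.1.im, z.2.2⟩ ⟨w.1.im, w.2.2⟩
      map_smul' := fun c z => by
        ext
        · exact (A.map_sub (c.re • ⟨z.1.re, z.2.1⟩) (c.im • ⟨z.1.im, z.2.2⟩)).trans
            (by rw [A.map_smul, A.map_smul])
        · exact (A.map_add (c.re • ⟨z.1.im, z.2.2⟩) (c.im • ⟨z.1.re, z.2.1⟩)).trans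
            (by rw [A.map_smul, A.map_smul]) }

/-- The real block `P₁₁` of `P = [P₁₁ P₁₂; P₂₁ P₂₂]` acting in the complexification of `E`
(written as `E ⊕ i E`): `P₁₁ x = Re (P (x + i 0))`. -/
def realBlock (P : Cx E →L[ℂ] Cx E) : E →L[ℝ] E :=
  Cx.reL ∘L (P.restrictScalars ℝ) ∘L Cx.ofRealL

end Operators

/-! ### Semigroups and resolvents -/

/-- `G(t)`, `t ≥ 0`, is a `C₀`-semigroup in `E` (the values at negative times are irrelevant). -/
structure IsC0Semigroup {E : Type*} [NormedAddCommGroup E] [NormedSpace ℝ E]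
    (G : ℝ → E →L[ℝ] E) : Prop where
  map_zero : G 0 = ContinuousLinearMap.id ℝ E
  map_add : ∀ s t : ℝ, 0 ≤ s → 0 ≤ t → G (s + t) = G s ∘L G t
  continuousOn : ∀ x : E, ContinuousOn (fun t => G t x) (Ici 0)

/-- `Γ` is the graph of the generator of `G`. -/
def IsGeneratorGraph {E : Type*} [NormedAddCommGroup E] [NormedSpace ℝ E]
    (Γ : Submodule ℝ (E × E)) (G : ℝ → E →L[ℝ] E) : Prop :=
  ∀ x y : E, (x, y) ∈ Γ ↔ Tendsto (fun t : ℝ => t⁻¹ • (G t x - x)) (𝓝[>] 0) (𝓝 y)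

/-- The graph of the part of `A` in a space `V` embedded by `j`: all `(v, w)` such that
`j v ∈ D(A)` and `A (j v) = j w`. -/
def partGraph {E V : Type*} [NormedAddCommGroup E] [NormedSpace ℝ E]
    [NormedAddCommGroup V] [NormedSpace ℝ V] (j : V →L[ℝ] E) (A : E →ₗ.[ℝ] E) :
    Submodule ℝ (V × V) :=
  A.graph.comap ((j.prodMap j : V × V →L[ℝ] E × E) : V × V →ₗ[ℝ] E × E)

/-- `R` is the bounded inverse of `A - z I : D(A) → E`. -/
def IsResolventAt {E : Type*} [NormedAddCommGroup E] [NormedSpace ℂ E]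
    (A : E →ₗ.[ℂ] E) (z : ℂ) (R : E →L[ℂ] E) : Prop :=
  (∀ y : E, ∃ h : R y ∈ A.domain, A ⟨R y, h⟩ - z • R y = y) ∧
    ∀ x : A.domain, R (A x - z • (x : E)) = x

/-- The resolvent set of an unbounded operator (the complement of its spectrum). -/
def unboundedResolventSet {E : Type*} [NormedAddCommGroup E] [NormedSpace ℂ E]
    (A : E →ₗ.[ℂ] E) : Set ℂ :=
  {z | ∃ R : E →L[ℂ] E, IsResolventAt A z R}

open Classical in
/-- The resolvent `(A - z I)⁻¹` for `z` in the resolvent set of `A` (and `0` elsewhere). -/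
def unboundedResolvent {E : Type*} [NormedAddCommGroup E] [NormedSpace ℂ E]
    (A : E →ₗ.[ℂ] E) (z : ℂ) : E →L[ℂ] E :=
  if h : z ∈ unboundedResolventSet A then h.choose else 0

/-- Condition (RES) for an operator `A` in `E` and a space `V` embedded into `E` by `j`: there is
no spectrum on the imaginary axis and the operators `(A - iωI)⁻¹ : E → V` are bounded uniformly
in `ω ∈ ℝ`. -/
def RES {E V : Type*} [NormedAddCommGroup E] [NormedSpace ℂ E]
    [NormedAddCommGroup V] [NormedSpace ℂ V] (j : V →L[ℂ] E) (A : E →ₗ.[ℂ] E) : Prop :=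
  (∀ ω : ℝ, (ω : ℂ) * Complex.I ∈ unboundedResolventSet A) ∧
    ∃ M : ℝ, ∀ ω : ℝ, ∃ R : E →L[ℂ] V,
      j ∘L R = unboundedResolvent A ((ω : ℂ) * Complex.I) ∧ ‖R‖ ≤ M

/-! ### The quadratic form -/

/-- `F(v, ξ) = (F₁ v, v) + 2 (F₂ v, ξ) + (F₃ ξ, ξ)`. -/
def quadForm {V Ξ : Type*} [NormedAddCommGroup V] [InnerProductSpace ℝ V]
    [NormedAddCommGroup Ξ] [InnerProductSpace ℝ Ξ]
    (F₁ : V →L[ℝ] V) (F₂ : V →L[ℝ] Ξ) (F₃ : Ξ →L[ℝ] Ξ) (v : V) (ξ : Ξ) : ℝ :=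
  inner ℝ (F₁ v) v + 2 * inner ℝ (F₂ v) ξ + inner ℝ (F₃ ξ) ξ

/-- Hermitian extension of a real quadratic form:
`F(v₁ + i v₂, ξ₁ + i ξ₂) = F(v₁, ξ₁) + F(v₂, ξ₂)`. -/
def hermExt {V Ξ : Type*} [NormedAddCommGroup V] [NormedAddCommGroup Ξ]
    (F : V → Ξ → ℝ) (v : Cx V) (ξ : Cx Ξ) : ℝ :=
  F v.re ξ.re + F v.im ξ.im

/-- Frequency inequality for complex operators: for some `δ' > 0`, all `ω ∈ ℝ` and all `ξ`, the
vector `v = -(A - iωI)⁻¹ B ξ` of `V` (embedded by `j`) satisfies `F(v, ξ) ≤ -δ' |ξ|²`. -/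
def FrequencyInequality {E V Ξ : Type*} [NormedAddCommGroup E] [NormedSpace ℂ E]
    [NormedAddCommGroup V] [NormedSpace ℂ V] [NormedAddCommGroup Ξ] [NormedSpace ℂ Ξ]
    (j : V →L[ℂ] E) (A : E →ₗ.[ℂ] E) (B : Ξ →L[ℂ] E) (F : V → Ξ → ℝ) : Prop :=
  ∃ δ' : ℝ, 0 < δ' ∧ ∀ (ω : ℝ) (ξ : Ξ) (v : V),
    j v = -unboundedResolvent A ((ω : ℂ) * Complex.I) (B ξ) → F v ξ ≤ -δ' * ‖ξ‖ ^ 2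

/-! ### Mild solutions and the Lyapunov inequality, over `𝕜 = ℝ` or `𝕜 = ℂ` -/

section Control

variable {𝕜 : Type*} [RCLike 𝕜]
  {E V Ξ : Type*} [NormedAddCommGroup E] [NormedSpace ℝ E] [NormedSpace 𝕜 E]
  [NormedAddCommGroup V] [InnerProductSpace 𝕜 V] [NormedAddCommGroup Ξ] [NormedSpace 𝕜 Ξ]

/-- `v` is a mild solution on `[0, T]`, starting at `v₀ ∈ V`, of the control system
`v' = A v + B ξ` in `E`, where `A` generates `G`, and `v` is continuous as a function with values
in `V` (embedded by `j`):
`v(t) = G(t) v₀ + ∫₀ᵗ G(t - s) B ξ(s) ds` in `E` for `t ∈ [0, T]`, and `v ∈ C([0, T]; V)`. -/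
def IsMildSolution (j : V →L[𝕜] E) (G : ℝ → E →L[𝕜] E) (B : Ξ →L[𝕜] E)
    (T : ℝ) (v₀ : V) (ξ : ℝ → Ξ) (v : ℝ → V) : Prop :=
  v 0 = v₀ ∧ ContinuousOn v (Icc 0 T) ∧
    ∀ t ∈ Icc 0 T, j (v t) = G t (j v₀) + ∫ s in (0 : ℝ)..t, G (t - s) (B (ξ s))

/-- With `V(v) = (P v, v)` (a real number for self-adjoint `P`),
`V(v(T)) - V(v₀) + ∫₀ᵀ F(v, ξ) ds ≤ -δ ∫₀ᵀ (|v|² + |ξ|²) ds` for all `T ≥ 0`, all initial data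
`v₀ ∈ V` and all `ξ ∈ L₂(0, T; Ξ)` whose mild solution `v` lies in `C([0, T]; V)`. -/
def LyapunovInequality (j : V →L[𝕜] E) (G : ℝ → E →L[𝕜] E) (B : Ξ →L[𝕜] E)
    (F : V → Ξ → ℝ) (P : V →L[𝕜] V) (δ : ℝ) : Prop :=
  ∀ T : ℝ, 0 ≤ T → ∀ (v₀ : V) (ξ : ℝ → Ξ) (v : ℝ → V),
    MemLp ξ 2 (volume.restrict (Icc 0 T)) → IsMildSolution j G B T v₀ ξ v →
    RCLike.re (inner 𝕜 (P (v T)) (v T)) - RCLike.re (inner 𝕜 (P v₀) v₀)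
        + ∫ s in (0 : ℝ)..T, F (v s) (ξ s)
      ≤ -δ * ∫ s in (0 : ℝ)..T, (‖v s‖ ^ 2 + ‖ξ s‖ ^ 2)

end Control

end FreqThm

end

/-! The operator `P` is the value function of a linear-quadratic problem. Maximising `∫ F(v, ξ)`
directly over solutions of `v' = A v + B ξ` is not possible in general, since `G` need not be stable
and a given state may have no square integrable solution. The system is therefore relaxed to `v' = A
v + f` with an arbitrary source `f`, and deviation from the true control is penalised by `-N |f - B
ξ|²`. Now every state `x` is steered to zero in unit time by `v(t) = (1 - t) G(t) x`, `f(t) = -G(t)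
x` (`ExtState.exists_trajectory`, with the semigroup of the part of `A`). For large `N` the
frequency inequality survives the relaxation and becomes coercive in `(v, ξ, f)`
(`exists_extended_frequency_inequality`), because (RES) bounds the resolvents into the smaller space
uniformly.

Plancherel's theorem turns this pointwise inequality into coercivity of the cost on square
integrable trajectories starting at zero (`integral_quadratic_nonpos`,
`ExtState.coercive_of_frequency`). The supremum of the cost over trajectories from `x` is then
finite, satisfies the parallelogram law, and is `(P x, x)` with `P` bounded and self-adjoint
(`exists_value_operator`). Concatenating a mild solution on `[0, T]`, where `f = B ξ` and the
penalty vanishes, with an arbitrary continuation from `v(T)` gives the Lyapunov inequality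
(`exists_lyapunov_of_frequency`).

Relaxed trajectories are described by `A⁻¹ v = A⁻¹ v₀ + ∫ (v + A⁻¹ f)`, which needs no derivatives
and uses only bounded operators; `IsC0Semigroup.inverse_mild` derives it for mild solutions.

Conversely, along the real and imaginary parts of `exp(iωt) (v, ξ)` over a full period the boundary
terms cancel, and the frequency inequality remains (`frequency_of_lyapunov`). A real `P` is
complexified by adding the inequalities for real and imaginary parts; the real block is obtained by
testing with real solutions. -/

noncomputable section

namespace FreqThm

/-! ### Plancherel's theorem for integrable and square integrable Hilbert-space valued functions -/

section Plancherel

open FourierTransform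

variable {F : Type*} [NormedAddCommGroup F] [InnerProductSpace ℂ F] [CompleteSpace F]

/-- On `L¹ ∩ L²` the `L²` Fourier transform is given by the Fourier integral. -/
lemma coeFn_fourier_toLp {f : ℝ → F} (hf₁ : Integrable f) (hf₂ : MemLp f 2) :
    ((𝓕 (hf₂.toLp f) : Lp F 2 (volume : Measure ℝ)) : ℝ → F) =ᵐ[volume] 𝓕 f := by
  have hcont : Continuous (𝓕 f) :=
    VectorFourier.fourierIntegral_continuous Real.continuous_fourierChar
      continuous_inner hf₁
  have hloc : LocallyIntegrable
      ((𝓕 (hf₂.toLp f) : Lp F 2 (volume : Measure ℝ)) : ℝ → F) volume :=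
    (Lp.memLp _).locallyIntegrable (by norm_num)
  -- Both functions are tested against smooth `g` of compact support: the `L²` transform agrees with
  -- the distributional one, and the Fourier integral moves between the factors of `∫ φ f` by
  -- Fubini.
  refine ae_eq_of_integral_contDiff_smul_eq hloc hcont.locallyIntegrable ?_
  intro g hg hgs
  have hgs' : HasCompactSupport (fun x => (g x : ℂ)) :=
    hgs.comp_left (g := fun x : ℝ => (x : ℂ)) (by simp)
  have hg' : ContDiff ℝ ((⊤ : ℕ∞) : WithTop ℕ∞) (fun x => (g x : ℂ)) :=
    Complex.ofRealCLM.contDiff.comp hg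
  set φ : SchwartzMap ℝ ℂ := hgs'.toSchwartzMap hg' with hφ
  have hφx : ∀ x, φ x = (g x : ℂ) := fun x => rfl
  have h := congrArg (fun T => T φ) (Lp.fourier_toTemperedDistribution_eq (hf₂.toLp f))
  simp only [TemperedDistribution.fourier_apply, Lp.toTemperedDistribution_apply] at h
  have h1 : ∫ x, (𝓕 φ) x • (hf₂.toLp f : ℝ → F) x = ∫ x, (𝓕 φ) x • f x := by
    refine integral_congr_ae ?_
    filter_upwards [hf₂.coeFn_toLp] with x hx
    rw [hx]
  have h2 : ∫ x, (𝓕 φ) x • f x = ∫ x, φ x • (𝓕 f) x := by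
    have := VectorFourier.integral_fourierIntegral_smul_eq_flip (μ := volume) (ν := volume)
      (e := Real.fourierChar) (L := innerₗ ℝ) (f := φ) (g := f) Real.continuous_fourierChar
      continuous_inner φ.integrable hf₁
    rw [flip_innerₗ] at this
    exact this
  rw [h1, h2] at h
  simpa [hφx] using h.symm

lemma memLp_fourier {f : ℝ → F} (hf₁ : Integrable f) (hf₂ : MemLp f 2) :
    MemLp (𝓕 f) 2 :=
  (memLp_congr_ae (coeFn_fourier_toLp hf₁ hf₂)).1 (Lp.memLp _)

lemma integral_inner_fourier {f g : ℝ → F} (hf₁ : Integrable f) (hf₂ : MemLp f 2)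
    (hg₁ : Integrable g) (hg₂ : MemLp g 2) :
    ∫ ω, inner ℂ (𝓕 f ω) (𝓕 g ω) = ∫ t, inner ℂ (f t) (g t) := by
  have h := Lp.inner_fourier_eq (hf₂.toLp f) (hg₂.toLp g)
  rw [L2.inner_def, L2.inner_def] at h
  calc _ = _ := integral_congr_ae (by
        filter_upwards [coeFn_fourier_toLp hf₁ hf₂, coeFn_fourier_toLp hg₁ hg₂] with x h1 h2
        rw [h1, h2])
    _ = _ := h
    _ = _ := integral_congr_ae (by
        filter_upwards [hf₂.coeFn_toLp, hg₂.coeFn_toLp] with x h1 h2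
        rw [h1, h2])

end Plancherel

lemma integrable_inner_of_memLp_two {𝕜 α F : Type*} [RCLike 𝕜] [MeasurableSpace α]
    {μ : Measure α} [NormedAddCommGroup F] [InnerProductSpace 𝕜 F] {f g : α → F}
    (hf : MemLp f 2 μ) (hg : MemLp g 2 μ) : Integrable (fun x => inner 𝕜 (f x) (g x)) μ := by
  refine (L2.integrable_inner (𝕜 := 𝕜) (hf.toLp f) (hg.toLp g)).congr ?_
  filter_upwards [hf.coeFn_toLp, hg.coeFn_toLp] with x h1 h2
  rw [h1, h2]

/-! ### Laplace transform of a primitive -/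

section Laplace

variable {F : Type*} [NormedAddCommGroup F] [NormedSpace ℂ F] [CompleteSpace F]

/-- The Laplace transform turns integration into division by the variable. -/
lemma smul_laplace_primitive {g : ℝ → F} {z : ℂ} (hz : 0 < z.re)
    (hgm : AEStronglyMeasurable g (volume.restrict (Ioi 0)))
    (hg : IntegrableOn (fun t : ℝ => Complex.exp (-z * t) • g t) (Ioi 0)) :
    z • ∫ t in Ioi (0 : ℝ), Complex.exp (-z * t) • ∫ s in (0 : ℝ)..t, g s =
      ∫ t in Ioi (0 : ℝ), Complex.exp (-z * t) • g t := by
  have hz0 : z ≠ 0 := by rintro rfl; simp at hz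
  have hz' : (-z).re < 0 := by simpa using hz
  set μ : Measure ℝ := volume.restrict (Ioi 0)
  -- Fubini on the triangle `0 < s ≤ t`: integrating first in `t` produces the factor `z⁻¹ exp(-z
  -- s)`, integrating first in `s` produces the primitive.
  set k : ℝ × ℝ → F :=
    {p : ℝ × ℝ | p.1 ≤ p.2}.indicator fun p => Complex.exp (-z * p.2) • g p.1
  have hkm : AEStronglyMeasurable k (μ.prod μ) := by
    refine AEStronglyMeasurable.indicator ?_ (measurableSet_le measurable_fst measurable_snd)
    exact (Continuous.aestronglyMeasurable (by fun_prop)).smul hgm.comp_fst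
  have hk_fst : ∀ s : ℝ, (fun t => k (s, t)) =
      (Ici s).indicator fun t => Complex.exp (-z * t) • g s := by
    intro s; ext t; simp [k, indicator]
  have hk_snd : ∀ t : ℝ, (fun s => k (s, t)) =
      (Iic t).indicator fun s => Complex.exp (-z * t) • g s := by
    intro t; ext s; simp [k, indicator]
  have hrestr : ∀ s ∈ Ioi (0 : ℝ), μ.restrict (Ici s) = volume.restrict (Ici s) := by
    intro s hs
    rw [Measure.restrict_restrict measurableSet_Ici]
    congr 1
    exact inter_eq_left.2 fun x hx => (mem_Ioi.1 hs).trans_le (mem_Ici.1 hx)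
  have hint1 : ∀ s ∈ Ioi (0 : ℝ), ∫ t, k (s, t) ∂μ = (z⁻¹ * Complex.exp (-z * s)) • g s := by
    intro s hs
    rw [hk_fst, integral_indicator measurableSet_Ici, hrestr s hs, integral_smul_const,
      integral_Ici_eq_integral_Ioi, integral_exp_mul_complex_Ioi hz']
    congr 1
    field_simp
  have hint2 : ∀ t ∈ Ioi (0 : ℝ),
      ∫ s, k (s, t) ∂μ = Complex.exp (-z * t) • ∫ s in (0 : ℝ)..t, g s := by
    intro t ht
    rw [hk_snd, integral_indicator measurableSet_Iic, Measure.restrict_restrict measurableSet_Iic,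
      integral_smul, intervalIntegral.integral_of_le (le_of_lt ht)]
    congr 3
    rw [inter_comm, Ioi_inter_Iic]
  have hk : Integrable k (μ.prod μ) := by
    refine (integrable_prod_iff hkm).2 ⟨?_, ?_⟩
    · filter_upwards [ae_restrict_mem measurableSet_Ioi] with s hs
      rw [hk_fst, integrable_indicator_iff measurableSet_Ici, IntegrableOn, hrestr s hs]
      refine Integrable.smul_const ?_ _
      exact (integrableOn_Ici_iff_integrableOn_Ioi).2 (integrableOn_exp_mul_complex_Ioi hz' s)
    · refine (hg.norm.const_mul (z.re⁻¹)).congr ?_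
      filter_upwards [ae_restrict_mem measurableSet_Ioi] with s hs
      have : (fun t => ‖k (s, t)‖) =
          (Ici s).indicator fun t => Real.exp ((-z.re) * t) * ‖g s‖ := by
        ext t
        rw [congrFun (hk_fst s) t, norm_indicator_eq_indicator_norm]
        simp [indicator, norm_smul, Complex.norm_exp]
      rw [this, integral_indicator measurableSet_Ici, hrestr s hs, integral_mul_const,
        integral_Ici_eq_integral_Ioi, integral_exp_mul_Ioi (by linarith)]
      rw [norm_smul, Complex.norm_exp]
      simp
      field_simp
  have hswap := integral_integral_swap (f := fun s t => k (s, t)) hk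
  have e1 : ∫ s, ∫ t, k (s, t) ∂μ ∂μ = z⁻¹ • ∫ t, Complex.exp (-z * t) • g t ∂μ := by
    rw [← integral_smul]
    refine setIntegral_congr_fun measurableSet_Ioi fun s hs => ?_
    simp only [hint1 s hs, mul_smul]
  have e2 : ∫ t, ∫ s, k (s, t) ∂μ ∂μ =
      ∫ t, Complex.exp (-z * t) • (∫ s in (0 : ℝ)..t, g s) ∂μ :=
    setIntegral_congr_fun measurableSet_Ioi fun t ht => hint2 t ht
  rw [e1, e2] at hswap
  rw [← hswap, smul_inv_smul₀ hz0]

end Laplace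

section Cx

variable {E : Type*} [NormedAddCommGroup E]

@[simp] lemma Cx.re_neg (z : Cx E) : (-z).re = -z.re := rfl
@[simp] lemma Cx.im_neg (z : Cx E) : (-z).im = -z.im := rfl
@[simp] lemma Cx.re_sub (z w : Cx E) : (z - w).re = z.re - w.re := rfl
@[simp] lemma Cx.im_sub (z w : Cx E) : (z - w).im = z.im - w.im := rfl

end Cx

/-! ### From a frequency-domain inequality to a time-domain inequality -/

section Coercivity

open FourierTransform

variable {Z W : Type*} [NormedAddCommGroup Z] [InnerProductSpace ℝ Z]
  [NormedAddCommGroup W] [InnerProductSpace ℝ W]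

@[simp] lemma re_complexify (T : Z →L[ℝ] W) (z : Cx Z) : (complexify T z).re = T z.re := rfl
@[simp] lemma im_complexify (T : Z →L[ℝ] W) (z : Cx Z) : (complexify T z).im = T z.im := rfl
@[simp] lemma re_ofRealL (x : Z) : (Cx.ofRealL x).re = x := rfl
@[simp] lemma im_ofRealL (x : Z) : (Cx.ofRealL x).im = 0 := rfl

lemma complexify_ofRealL (T : Z →L[ℝ] W) (x : Z) :
    complexify T (Cx.ofRealL x) = Cx.ofRealL (T x) := by ext <;> simp

lemma norm_ofRealL (x : Z) : ‖Cx.ofRealL x‖ = ‖x‖ := by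
  have h := Cx.norm_sq (Cx.ofRealL x)
  simp only [re_ofRealL, im_ofRealL, norm_zero] at h
  exact (pow_left_inj₀ (norm_nonneg _) (norm_nonneg _) two_ne_zero).1 (by simpa using h)

lemma re_inner_complexify (Q : Z →L[ℝ] Z) (z : Cx Z) :
    (inner ℂ z (complexify Q z)).re = inner ℝ (Q z.re) z.re + inner ℝ (Q z.im) z.im := by
  simp [Cx.inner_def, real_inner_comm]

lemma fourier_clm_comp {F G : Type*} [NormedAddCommGroup F] [NormedSpace ℂ F] [CompleteSpace F]
    [NormedAddCommGroup G] [NormedSpace ℂ G] [CompleteSpace G] (T : F →L[ℂ] G) {f : ℝ → F}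
    (hf : Integrable f) (ω : ℝ) : 𝓕 (fun t => T (f t)) ω = T (𝓕 f ω) := by
  rw [Real.fourier_real_eq_integral_exp_smul, Real.fourier_real_eq_integral_exp_smul,
    ← T.integral_comp_comm]
  · simp
  · have := (Real.fourierIntegral_convergent_iff (μ := volume) ω).2 hf
    refine this.congr (ae_of_all _ fun t => ?_)
    simp [Real.fourierChar_apply, Circle.smul_def]
    ring_nf

variable [CompleteSpace Z] [CompleteSpace W]

/-- A trajectory is only square integrable, so it is damped by `exp(-ε t)` to make it integrable as
well. Damping moves the frequency equation off the imaginary axis, to `(ε + iω) C ζ = D ζ`. The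
operator `E` moves it back: by `C E = 0` and `D E = C`, the vector `(1 - ε E) ζ` solves `iω C = D`
exactly, so `hfreq` applies to it and Plancherel gives the sign of the integral. -/
lemma integral_damped_nonpos (C D : Z →L[ℝ] W) (E Q : Z →L[ℝ] Z) (hCE : C ∘L E = 0)
    (hDE : D ∘L E = C)
    (hfreq : ∀ (ω : ℝ) (ζ : Cx Z), ((ω : ℂ) * Complex.I) • complexify C ζ = complexify D ζ →
      inner ℝ (Q ζ.re) ζ.re + inner ℝ (Q ζ.im) ζ.im ≤ 0)
    {z : ℝ → Z} (hz : MemLp z 2 (volume.restrict (Ioi 0)))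
    (htraj : ∀ t, 0 ≤ t → C (z t) = ∫ s in (0 : ℝ)..t, D (z s)) {ε : ℝ} (hε : 0 < ε) :
    ∫ t in Ioi (0 : ℝ), Real.exp (-ε * t) ^ 2 *
      inner ℝ (Q (z t - ε • E (z t))) (z t - ε • E (z t)) ≤ 0 := by
  set U : Z →L[ℝ] Z := ContinuousLinearMap.id ℝ Z - ε • E with hU
  set zε : ℝ → Cx Z := (Ioi (0 : ℝ)).indicator
    fun t => (Real.exp (-ε * t)) • Cx.ofRealL (z t) with hzε
  have hexp2 : MemLp (fun t : ℝ => Real.exp (-ε * t)) 2 (volume.restrict (Ioi 0)) := by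
    rw [memLp_two_iff_integrable_sq (Continuous.aestronglyMeasurable (by fun_prop))]
    have := integrableOn_exp_mul_Ioi (a := -(2 * ε)) (by linarith) 0
    refine this.congr (ae_of_all _ fun t => ?_)
    simp only [← Real.exp_nat_mul]
    congr 1; push_cast; ring
  have hozm : MemLp (fun t => Cx.ofRealL (z t)) 2 (volume.restrict (Ioi 0)) :=
    Cx.ofRealL.comp_memLp' hz
  have hzε₁ : Integrable zε := by
    rw [hzε, integrable_indicator_iff measurableSet_Ioi]
    exact (memLp_one_iff_integrable.1 (MemLp.smul (𝕜 := ℝ) (p := 2) (q := 2) (r := 1) hozm hexp2))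
  have hzε₂ : MemLp zε 2 := by
    rw [hzε, memLp_indicator_iff_restrict measurableSet_Ioi]
    refine hozm.mono (hexp2.1.smul hozm.1) ?_
    filter_upwards [ae_restrict_mem measurableSet_Ioi] with t ht
    rw [norm_smul, Real.norm_of_nonneg (Real.exp_nonneg _)]
    have : Real.exp (-ε * t) ≤ 1 := by
      rw [Real.exp_le_one_iff]; nlinarith [mem_Ioi.1 ht]
    exact mul_le_of_le_one_left (norm_nonneg _) this
  have hFz : ∀ ω : ℝ, 𝓕 zε ω = ∫ t in Ioi (0 : ℝ),
      Complex.exp (-(ε + 2 * Real.pi * ω * Complex.I) * t) • Cx.ofRealL (z t) := by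
    intro ω
    rw [Real.fourier_real_eq_integral_exp_smul, ← integral_indicator measurableSet_Ioi]
    refine integral_congr_ae (ae_of_all _ fun t => ?_)
    by_cases ht : t ∈ Ioi (0 : ℝ)
    · simp only [hzε, indicator_of_mem ht]
      rw [← Complex.coe_smul, smul_smul]
      congr 1
      rw [Complex.ofReal_exp, ← Complex.exp_add]
      congr 1; push_cast; ring
    · simp only [hzε, indicator_of_notMem ht, smul_zero]
  have hgint : ∀ (ω : ℝ), IntegrableOn (fun t : ℝ =>
      Complex.exp (-(ε + 2 * Real.pi * ω * Complex.I) * t) • Cx.ofRealL (z t)) (Ioi 0) := by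
    intro ω
    have h1 := (integrable_indicator_iff measurableSet_Ioi).1 hzε₁
    refine Integrable.mono h1 ?_ ?_
    · have hem : AEStronglyMeasurable (fun t : ℝ =>
          Complex.exp (-(ε + 2 * Real.pi * ω * Complex.I) * t)) (volume.restrict (Ioi 0)) :=
        Continuous.aestronglyMeasurable (by fun_prop)
      exact hem.smul hozm.1
    · refine ae_of_all _ fun t => ?_
      rw [norm_smul, norm_smul, Complex.norm_exp, Real.norm_of_nonneg (Real.exp_nonneg _)]
      simp
  -- The Fourier transform of the damped trajectory is the Laplace transform of `z` at `ε + 2πiω`,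
  -- where integration in time is division by that variable.
  have hkey : ∀ ω : ℝ, ((ε : ℂ) + 2 * Real.pi * ω * Complex.I) • complexify C (𝓕 zε ω) =
      complexify D (𝓕 zε ω) := by
    intro ω
    have hint := hgint ω
    rw [hFz, ← (complexify C).integral_comp_comm hint, ← (complexify D).integral_comp_comm hint]
    simp only [map_smul, complexify_ofRealL]
    rw [← smul_laplace_primitive (z := (ε : ℂ) + 2 * Real.pi * ω * Complex.I)
      (g := fun t => Cx.ofRealL (D (z t))) (by simpa using hε)]
    · refine congrArg _ (setIntegral_congr_fun measurableSet_Ioi fun t ht => ?_)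
      rw [htraj t (le_of_lt ht), ← ContinuousLinearMap.intervalIntegral_comp_comm]
      rw [intervalIntegrable_iff_integrableOn_Ioc_of_le (le_of_lt ht)]
      have h3 : MemLp (fun s => D (z s)) 2 (volume.restrict (Ioc 0 t)) :=
        D.comp_memLp' (hz.mono_measure (Measure.restrict_mono Ioc_subset_Ioi_self le_rfl))
      exact h3.integrable (by norm_num)
    · exact (Cx.ofRealL.comp_memLp' (D.comp_memLp' hz)).1
    · have := (complexify D).integrable_comp hint
      simp only [map_smul, complexify_ofRealL] at this
      exact this
  set y : ℝ → Cx Z := fun t => complexify U (zε t) with hy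
  have hy₁ : Integrable y := (complexify U).integrable_comp hzε₁
  have hy₂ : MemLp y 2 := (complexify U).comp_memLp' hzε₂
  have hq₁ : Integrable (fun t => complexify Q (y t)) := (complexify Q).integrable_comp hy₁
  have hq₂ : MemLp (fun t => complexify Q (y t)) 2 := (complexify Q).comp_memLp' hy₂
  have hpl := integral_inner_fourier hy₁ hy₂ hq₁ hq₂
  have hFy : ∀ ω, 𝓕 y ω = complexify U (𝓕 zε ω) := fourier_clm_comp _ hzε₁
  have hFq : ∀ ω, 𝓕 (fun t => complexify Q (y t)) ω = complexify Q (𝓕 y ω) :=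
    fourier_clm_comp _ hy₁
  have hle : (∫ ω, inner ℂ (𝓕 y ω) (𝓕 (fun t => complexify Q (y t)) ω)).re ≤ 0 := by
    rw [← Complex.reCLM_apply, ← Complex.reCLM.integral_comp_comm]
    · refine integral_nonpos fun ω => ?_
      simp only [Complex.reCLM_apply, hFq, re_inner_complexify]
      -- The factor `2π` comes from the normalisation `exp(-2πiωt)` of the Fourier kernel.
      refine hfreq (2 * Real.pi * ω) _ ?_
      have hC : complexify C (𝓕 y ω) = complexify C (𝓕 zε ω) := by
        have h0 : ∀ x, C (E x) = 0 := fun x => DFunLike.congr_fun hCE x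
        rw [hFy]; ext <;> simp [hU, h0]
      have hD : complexify D (𝓕 y ω) =
          complexify D (𝓕 zε ω) - (ε : ℂ) • complexify C (𝓕 zε ω) := by
        have h0 : ∀ x, D (E x) = C x := fun x => DFunLike.congr_fun hDE x
        rw [hFy]; ext <;> simp [hU, h0]
      rw [hC, hD, ← hkey ω, ← sub_smul]
      congr 1; push_cast; ring
    · exact integrable_inner_of_memLp_two (memLp_fourier hy₁ hy₂) (memLp_fourier hq₁ hq₂)
  rw [hpl, ← Complex.reCLM_apply, ← Complex.reCLM.integral_comp_comm
    (integrable_inner_of_memLp_two hy₂ hq₂)] at hle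
  refine le_of_eq_of_le ?_ hle
  rw [← integral_indicator measurableSet_Ioi]
  refine integral_congr_ae (ae_of_all _ fun t => ?_)
  simp only [Complex.reCLM_apply, re_inner_complexify]
  by_cases ht : t ∈ Ioi (0 : ℝ)
  · simp only [hy, hzε, indicator_of_mem ht]
    simp [hU, inner_smul_left, inner_smul_right]
    ring
  · simp only [hy, hzε, indicator_of_notMem ht]
    simp

/-- A quadratic form which is non-positive on all solutions `ζ` of the frequency-domain equation
`iω C ζ = D ζ` has a non-positive integral along every square integrable solution of
`C z(t) = ∫₀ᵗ D z(s) ds`. -/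
lemma integral_quadratic_nonpos (C D : Z →L[ℝ] W) (E Q : Z →L[ℝ] Z) (hCE : C ∘L E = 0)
    (hDE : D ∘L E = C)
    (hfreq : ∀ (ω : ℝ) (ζ : Cx Z), ((ω : ℂ) * Complex.I) • complexify C ζ = complexify D ζ →
      inner ℝ (Q ζ.re) ζ.re + inner ℝ (Q ζ.im) ζ.im ≤ 0)
    {z : ℝ → Z} (hz : MemLp z 2 (volume.restrict (Ioi 0)))
    (htraj : ∀ t, 0 ≤ t → C (z t) = ∫ s in (0 : ℝ)..t, D (z s)) :
    ∫ t in Ioi (0 : ℝ), inner ℝ (Q (z t)) (z t) ≤ 0 := by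
  -- For `0 < ε < 1` the correction satisfies `‖z - ε E z‖ ≤ (1 + ‖E‖) ‖z‖`, so `c ‖z‖²` dominates
  -- the damped integrands as `ε → 0`.
  set c : ℝ := ‖Q‖ * (1 + ‖E‖) ^ 2
  have hlim : Tendsto (fun ε : ℝ => ∫ t in Ioi (0 : ℝ), Real.exp (-ε * t) ^ 2 *
      inner ℝ (Q (z t - ε • E (z t))) (z t - ε • E (z t))) (𝓝[>] 0)
      (𝓝 (∫ t in Ioi (0 : ℝ), inner ℝ (Q (z t)) (z t))) := by
    refine tendsto_integral_filter_of_dominated_convergence (fun t => c * ‖z t‖ ^ 2) ?_ ?_ ?_ ?_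
    · refine Eventually.of_forall fun ε => ?_
      refine (Continuous.aestronglyMeasurable (by fun_prop)).mul ?_
      exact Continuous.comp_aestronglyMeasurable
        (g := fun x => inner ℝ (Q (x - ε • E x)) (x - ε • E x)) (by fun_prop) hz.1
    · filter_upwards [self_mem_nhdsWithin, mem_nhdsWithin_of_mem_nhds (Iio_mem_nhds one_pos)]
        with ε hε hε1
      filter_upwards [ae_restrict_mem measurableSet_Ioi] with t ht
      have h1 : ‖z t - ε • E (z t)‖ ≤ (1 + ‖E‖) * ‖z t‖ := by
        refine (norm_sub_le _ _).trans ?_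
        rw [norm_smul, Real.norm_of_nonneg (le_of_lt hε), add_mul, one_mul]
        have := E.le_opNorm (z t)
        have hε0 : (0 : ℝ) < ε := hε
        have hε1' : ε < 1 := hε1
        nlinarith [norm_nonneg (E (z t))]
      have h2 : Real.exp (-ε * t) ≤ 1 := by
        rw [Real.exp_le_one_iff]; nlinarith [mem_Ioi.1 ht, mem_Ioi.1 hε]
      rw [norm_mul, norm_pow, Real.norm_of_nonneg (Real.exp_nonneg _)]
      calc _ ≤ 1 * ‖inner ℝ (Q (z t - ε • E (z t))) (z t - ε • E (z t))‖ := by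
            gcongr
            exact pow_le_one₀ (Real.exp_nonneg _) h2
        _ ≤ ‖Q (z t - ε • E (z t))‖ * ‖z t - ε • E (z t)‖ := by
            rw [one_mul]; exact norm_inner_le_norm _ _
        _ ≤ (‖Q‖ * ((1 + ‖E‖) * ‖z t‖)) * ((1 + ‖E‖) * ‖z t‖) := by
            gcongr
            exact (Q.le_opNorm _).trans (by gcongr)
        _ = c * ‖z t‖ ^ 2 := by simp only [c]; ring
    · exact (hz.integrable_norm_pow two_ne_zero).const_mul c
    · refine ae_of_all _ fun t => ?_
      have : Continuous fun ε : ℝ => Real.exp (-ε * t) ^ 2 *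
          inner ℝ (Q (z t - ε • E (z t))) (z t - ε • E (z t)) := by fun_prop
      simpa using (this.tendsto 0).mono_left nhdsWithin_le_nhds
  refine le_of_tendsto hlim ?_
  filter_upwards [self_mem_nhdsWithin] with ε hε
  exact integral_damped_nonpos C D E Q hCE hDE hfreq hz htraj hε

end Coercivity

/-! ### Quadratic forms from the parallelogram law -/

section JordanVonNeumann

variable {X : Type*} [NormedAddCommGroup X] [InnerProductSpace ℝ X]

/-- Additivity alone allows scaling by integers. Replacing `x` by `n x` with `n = ⌊‖y‖ / ‖x‖⌋`
balances the two norms up to a factor two, which turns a bound by a sum of squares into a bound by a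
product. The resulting continuity is what upgrades additivity to real homogeneity. -/
lemma bound_of_additive {X Y : Type*} [NormedAddCommGroup X] [NormedAddCommGroup Y]
    {f : X → Y → ℝ} {c : ℝ} (hf : ∀ x x' y, f (x + x') y = f x y + f x' y)
    (hb : ∀ x y, |f x y| ≤ c * (‖x‖ ^ 2 + ‖y‖ ^ 2)) {x : X} {y : Y} (hxy : ‖x‖ ≤ ‖y‖) :
    |f x y| ≤ 4 * c * (‖x‖ * ‖y‖) := by
  have hn : ∀ n : ℕ, f (n • x) y = n * f x y := by
    intro n
    have := map_nsmul (AddMonoidHom.mk' (fun x => f x y) fun x x' => hf x x' y) n x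
    simpa using this
  rcases eq_or_ne x 0 with rfl | hx
  · have : f 0 y = 0 := by simpa using hn 0
    simp [this]
  have hx0 : 0 < ‖x‖ := norm_pos_iff.2 hx
  have hy0 : 0 < ‖y‖ := hx0.trans_le hxy
  set n : ℕ := ⌊‖y‖ / ‖x‖⌋₊ with hndef
  have h1 : 1 ≤ n := Nat.one_le_floor_iff _ |>.2 ((one_le_div hx0).2 hxy)
  have h1' : (1 : ℝ) ≤ n := by exact_mod_cast h1
  have hle : (n : ℝ) * ‖x‖ ≤ ‖y‖ := (le_div_iff₀ hx0).1 (Nat.floor_le (by positivity))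
  have hlt : ‖y‖ < (n + 1) * ‖x‖ := (div_lt_iff₀ hx0).1 (Nat.lt_floor_add_one _)
  have hb' := hb (n • x) y
  rw [hn, abs_mul, Nat.abs_cast] at hb'
  have hnx : ‖n • x‖ ≤ ‖y‖ := (norm_nsmul_le).trans (by simpa using hle)
  have hc : 0 ≤ c := by
    have := (abs_nonneg _).trans (hb x y)
    by_contra hc
    have : c * (‖x‖ ^ 2 + ‖y‖ ^ 2) < 0 := mul_neg_of_neg_of_pos (not_le.1 hc) (by positivity)
    linarith
  have h2 : (n : ℝ) * |f x y| ≤ c * (2 * ‖y‖ ^ 2) := by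
    refine hb'.trans (mul_le_mul_of_nonneg_left ?_ hc)
    have := pow_le_pow_left₀ (norm_nonneg _) hnx 2
    linarith
  have h3 : ‖y‖ ≤ n * (2 * ‖x‖) := by nlinarith
  have h4 : c * (2 * ‖y‖ ^ 2) ≤ n * (4 * c * (‖x‖ * ‖y‖)) := by
    have := mul_le_mul_of_nonneg_left h3 (by positivity : 0 ≤ 2 * c * ‖y‖)
    linarith
  exact le_of_mul_le_mul_left (h2.trans h4) (by linarith)

/-- A bounded function satisfying the parallelogram law is the quadratic form of a bounded
self-adjoint operator. -/
lemma exists_selfAdjoint_of_parallelogram [CompleteSpace X] {V : X → ℝ} {c : ℝ}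
    (hV : ∀ x y, V (x + y) + V (x - y) = 2 * V x + 2 * V y) (hb : ∀ x, |V x| ≤ c * ‖x‖ ^ 2) :
    ∃ P : X →L[ℝ] X, IsSelfAdjoint P ∧ ∀ x, inner ℝ (P x) x = V x := by
  set b : X → X → ℝ := fun x y => (V (x + y) - V x - V y) / 2 with hbdef
  have hV0 : V 0 = 0 := by simpa using hb 0
  have hsymm : ∀ x y, b x y = b y x := fun x y => by simp only [hbdef, add_comm x y]; ring
  have hadd : ∀ x x' y, b (x + x') y = b x y + b x' y := by
    intro x x' y
    -- The combination `e1 - e2 + e3 + 2 e4` of these four parallelogram identities is additivity of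
    -- the polar form.
    have e1 := hV (x + y) x'
    have e2 := hV x (y - x')
    have e3 := hV (x + x') y
    have e4 := hV y x'
    rw [show x + y + x' = x + x' + y by abel] at e1
    rw [show x + (y - x') = x + y - x' by abel, show x - (y - x') = x + x' - y by abel] at e2
    rw [add_comm y x'] at e4
    simp only [hbdef]
    linarith
  have hdiag : ∀ x, b x x = V x := by
    intro x
    have := hV x x
    rw [sub_self, hV0] at this
    simp only [hbdef]
    linarith
  have hc : ∀ x : X, 0 ≤ c * ‖x‖ ^ 2 := fun x => (abs_nonneg _).trans (hb x)
  have hbb : ∀ x y, |b x y| ≤ 2 * c * (‖x‖ ^ 2 + ‖y‖ ^ 2) := by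
    intro x y
    have h1 := hb (x + y)
    have h2 := hb x
    have h3 := hb y
    have h4 := parallelogram_law_with_norm ℝ x y
    have h5 := hc (x - y)
    have h6 := hc x
    have h7 := hc y
    have h8 : c * ‖x + y‖ ^ 2 + c * ‖x - y‖ ^ 2 = 2 * (c * ‖x‖ ^ 2) + 2 * (c * ‖y‖ ^ 2) := by
      linear_combination c * h4
    rw [abs_le] at h1 h2 h3 ⊢
    simp only [hbdef]
    constructor <;> linarith [h1.1, h1.2, h2.1, h2.2, h3.1, h3.2]
  have hbnd : ∀ x y, |b x y| ≤ 8 * c * (‖x‖ * ‖y‖) := by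
    intro x y
    rcases le_total ‖x‖ ‖y‖ with h | h
    · have := bound_of_additive hadd hbb h
      linarith
    · have := bound_of_additive hadd hbb h
      rw [hsymm x y]
      linarith [mul_comm ‖x‖ ‖y‖]
  have hsmul : ∀ (r : ℝ) x y, b (r • x) y = r * b x y := by
    intro r x y
    let f : X →+ ℝ := AddMonoidHom.mk' (fun x => b x y) fun x x' => hadd x x' y
    have hf : Continuous f := AddMonoidHomClass.continuous_of_bound f (8 * c * ‖y‖) fun x => by
      have := hbnd x y
      simp only [f, AddMonoidHom.mk'_apply, Real.norm_eq_abs]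
      linarith
    exact (f.toRealLinearMap hf).map_smul r x
  let Bl : X →ₗ[ℝ] X →ₗ[ℝ] ℝ := LinearMap.mk₂ ℝ b hadd hsmul
    (fun x y y' => by rw [hsymm, hadd, hsymm y, hsymm y'])
    (fun r x y => by rw [hsymm, hsmul, hsymm y]; rfl)
  let Bc : X →L[ℝ] X →L[ℝ] ℝ := Bl.mkContinuous₂ (8 * c) fun x y => by
    have := hbnd x y
    simp only [Bl, LinearMap.mk₂_apply, Real.norm_eq_abs]
    linarith
  have hBc : ∀ x y, Bc x y = b x y := fun x y => rfl
  refine ⟨InnerProductSpace.continuousLinearMapOfBilin Bc, ?_, fun x => ?_⟩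
  · rw [ContinuousLinearMap.isSelfAdjoint_iff_isSymmetric]
    intro x y
    simp only [ContinuousLinearMap.coe_coe]
    rw [InnerProductSpace.continuousLinearMapOfBilin_apply, real_inner_comm,
      InnerProductSpace.continuousLinearMapOfBilin_apply, hBc, hBc, hsymm]
  · rw [InnerProductSpace.continuousLinearMapOfBilin_apply, hBc, hdiag]

end JordanVonNeumann

/-! ### The value function of a coercive linear-quadratic problem -/

section ValueFunction

variable {X Z : Type*} [NormedAddCommGroup X] [InnerProductSpace ℝ X] [CompleteSpace X]
  [NormedAddCommGroup Z] [InnerProductSpace ℝ Z]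

lemma integrable_inner_clm {α : Type*} [MeasurableSpace α] {μ : Measure α} (Q : Z →L[ℝ] Z)
    {z : α → Z} (hz : MemLp z 2 μ) : Integrable (fun t => inner ℝ (Q (z t)) (z t)) μ :=
  integrable_inner_of_memLp_two (𝕜 := ℝ) (Q.comp_memLp' hz) hz

/-- The value function of a coercive linear-quadratic problem is a bounded quadratic form. -/
lemma exists_value_operator {α : Type*} [MeasurableSpace α] {μ : Measure α} (Q : Z →L[ℝ] Z)
    (T : X → Set (α → Z)) (hmem : ∀ x, ∀ z ∈ T x, MemLp z 2 μ)
    (hadd : ∀ x y, ∀ z ∈ T x, ∀ w ∈ T y, z + w ∈ T (x + y))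
    (hsmul : ∀ (r : ℝ) x, ∀ z ∈ T x, r • z ∈ T (r • x)) {c δ : ℝ}
    (hlift : ∀ x, ∃ z ∈ T x, ∫ t, ‖z t‖ ^ 2 ∂μ ≤ c * ‖x‖ ^ 2) (hδ : 0 < δ)
    (hcoer : ∀ z ∈ T 0, ∫ t, inner ℝ (Q (z t)) (z t) ∂μ ≤ -δ * ∫ t, ‖z t‖ ^ 2 ∂μ) :
    ∃ P : X →L[ℝ] X, IsSelfAdjoint P ∧ ∀ x,
      IsLUB ((fun z : α → Z => ∫ t, inner ℝ (Q (z t)) (z t) ∂μ) '' T x) (inner ℝ (P x) x) := by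
  have hsub : ∀ x y, ∀ z ∈ T x, ∀ w ∈ T y, z - w ∈ T (x - y) := fun x y z hz w hw => by
    simpa [sub_eq_add_neg] using hadd x _ z hz _ (hsmul (-1) y w hw)
  set J : (α → Z) → ℝ := fun z => ∫ t, inner ℝ (Q (z t)) (z t) ∂μ with hJ
  have hpar : ∀ x y, ∀ z ∈ T x, ∀ w ∈ T y, J (z + w) + J (z - w) = 2 * J z + 2 * J w := by
    intro x y z hz w hw
    have iz := integrable_inner_clm Q (hmem x z hz)
    have iw := integrable_inner_clm Q (hmem y w hw)
    have ia := integrable_inner_clm Q (hmem _ _ (hadd x y z hz w hw))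
    have is := integrable_inner_clm Q (hmem _ _ (hsub x y z hz w hw))
    simp only [hJ]
    rw [← integral_add ia is, ← integral_const_mul, ← integral_const_mul,
      ← integral_add (iz.const_mul 2) (iw.const_mul 2)]
    refine integral_congr_ae (ae_of_all _ fun t => ?_)
    simp only [Pi.add_apply, Pi.sub_apply, map_add, map_sub, inner_add_left, inner_add_right,
      inner_sub_left, inner_sub_right]
    ring
  set c₁ : ℝ := ‖Q‖ + ‖Q‖ ^ 2 / δ with hc₁
  have hc₁0 : 0 ≤ c₁ := by positivity
  -- Young's inequality with weight `δ`: the mixed terms cost exactly the amount `δ ‖w‖²` that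
  -- coercivity on `T 0` can absorb.
  have hpt : ∀ z w : Z,
      inner ℝ (Q (z + w)) (z + w) ≤ inner ℝ (Q w) w + δ * ‖w‖ ^ 2 + c₁ * ‖z‖ ^ 2 := by
    intro z w
    have hq : ∀ a b : Z, inner ℝ (Q a) b ≤ ‖Q‖ * ‖a‖ * ‖b‖ := fun a b =>
      (real_inner_le_norm _ _).trans (by gcongr; exact Q.le_opNorm a)
    have h1 := hq z z
    have h2 := hq z w
    have h3 := hq w z
    simp only [map_add, inner_add_left, inner_add_right]
    have h4 : 2 * (‖Q‖ * ‖z‖ * ‖w‖) ≤ δ * ‖w‖ ^ 2 + ‖Q‖ ^ 2 / δ * ‖z‖ ^ 2 := by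
      have : 0 ≤ (δ * ‖w‖ - ‖Q‖ * ‖z‖) ^ 2 / δ := by positivity
      have e : (δ * ‖w‖ - ‖Q‖ * ‖z‖) ^ 2 / δ =
          δ * ‖w‖ ^ 2 + ‖Q‖ ^ 2 / δ * ‖z‖ ^ 2 - 2 * (‖Q‖ * ‖z‖ * ‖w‖) := by
        field_simp; ring
      linarith
    rw [hc₁]
    nlinarith
  -- Subtract from `u` the cheap trajectory `z` provided by `hlift`: the difference starts at zero
  -- and is controlled by `hcoer`, while `z` costs at most a multiple of `‖x‖²`.
  have hupper : ∀ x, ∀ u ∈ T x, J u ≤ c₁ * c * ‖x‖ ^ 2 := by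
    intro x u hu
    obtain ⟨z, hz, hzc⟩ := hlift x
    have hw : u - z ∈ T 0 := by simpa using hsub x x u hu z hz
    have iw := integrable_inner_clm Q (hmem _ _ hw)
    have nw := (hmem _ _ hw).integrable_norm_pow two_ne_zero
    have nz := (hmem _ _ hz).integrable_norm_pow two_ne_zero
    have i2 : Integrable (fun t => inner ℝ (Q ((u - z) t)) ((u - z) t) + δ * ‖(u - z) t‖ ^ 2) μ :=
      iw.add (nw.const_mul δ)
    have h1 : J u ≤ J (u - z) + δ * ∫ t, ‖(u - z) t‖ ^ 2 ∂μ + c₁ * ∫ t, ‖z t‖ ^ 2 ∂μ := by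
      simp only [hJ]
      rw [← integral_const_mul, ← integral_const_mul, ← integral_add iw (nw.const_mul δ),
        ← integral_add i2 (nz.const_mul c₁)]
      refine integral_mono (integrable_inner_clm Q (hmem _ _ hu))
        (i2.add (nz.const_mul c₁)) fun t => ?_
      have := hpt (z t) ((u - z) t)
      simpa using this
    have h2 := hcoer _ hw
    have h3 := mul_le_mul_of_nonneg_left hzc hc₁0
    simp only [hJ] at h1 ⊢
    linarith
  have hne : ∀ x, (J '' T x).Nonempty := fun x => by
    obtain ⟨z, hz, -⟩ := hlift x
    exact ⟨_, z, hz, rfl⟩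
  have hbdd : ∀ x, BddAbove (J '' T x) := fun x =>
    ⟨c₁ * c * ‖x‖ ^ 2, by rintro _ ⟨u, hu, rfl⟩; exact hupper x u hu⟩
  set V : X → ℝ := fun x => sSup (J '' T x) with hV
  have hlub : ∀ x, IsLUB (J '' T x) (V x) := fun x => isLUB_csSup (hne x) (hbdd x)
  -- Taking suprema in the parallelogram identity for `J` yields only this half of the law for `V`.
  have hge : ∀ x y, 2 * V x + 2 * V y ≤ V (x + y) + V (x - y) := by
    intro x y
    have key : ∀ z ∈ T x, ∀ w ∈ T y, 2 * J z + 2 * J w ≤ V (x + y) + V (x - y) := by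
      intro z hz w hw
      rw [← hpar x y z hz w hw]
      exact add_le_add ((hlub _).1 ⟨_, hadd x y z hz w hw, rfl⟩)
        ((hlub _).1 ⟨_, hsub x y z hz w hw, rfl⟩)
    have key2 : ∀ w ∈ T y, V x ≤ (V (x + y) + V (x - y) - 2 * J w) / 2 := by
      intro w hw
      refine (hlub x).2 ?_
      rintro _ ⟨z, hz, rfl⟩
      linarith [key z hz w hw]
    have key3 : V y ≤ (V (x + y) + V (x - y) - 2 * V x) / 2 := by
      refine (hlub y).2 ?_
      rintro _ ⟨w, hw, rfl⟩
      linarith [key2 w hw]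
    linarith
  have hc0 : ∀ x : X, 0 ≤ c * ‖x‖ ^ 2 := fun x => by
    obtain ⟨z, -, hzc⟩ := hlift x
    exact (integral_nonneg fun t => by positivity).trans hzc
  have hbound : ∀ x, |V x| ≤ c₁ * c * ‖x‖ ^ 2 := by
    intro x
    rw [abs_le]
    refine ⟨?_, (hlub x).2 (by rintro _ ⟨u, hu, rfl⟩; exact hupper x u hu)⟩
    obtain ⟨z, hz, hzc⟩ := hlift x
    have h1 : J z ≤ V x := (hlub x).1 ⟨z, hz, rfl⟩
    have nz := (hmem _ _ hz).integrable_norm_pow two_ne_zero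
    have h2 : -(‖Q‖ * ∫ t, ‖z t‖ ^ 2 ∂μ) ≤ J z := by
      rw [← integral_const_mul, ← integral_neg]
      refine integral_mono (nz.const_mul _).neg (integrable_inner_clm Q (hmem _ _ hz)) fun t => ?_
      have h := abs_real_inner_le_norm (Q (z t)) (z t)
      have h' : ‖Q (z t)‖ * ‖z t‖ ≤ ‖Q‖ * ‖z t‖ * ‖z t‖ := by gcongr; exact Q.le_opNorm _
      have := (abs_le.1 h).1
      simp only
      nlinarith
    have h3 : ‖Q‖ * ∫ t, ‖z t‖ ^ 2 ∂μ ≤ c₁ * (c * ‖x‖ ^ 2) := by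
      refine mul_le_mul ?_ hzc (integral_nonneg fun t => by positivity) hc₁0
      rw [hc₁]
      have : 0 ≤ ‖Q‖ ^ 2 / δ := by positivity
      linarith
    linarith
  have hV2 : ∀ x, V ((2 : ℝ) • x) ≤ 4 * V x := by
    refine fun x => (hlub _).2 ?_
    rintro _ ⟨u, hu, rfl⟩
    have h1 := (hlub x).1 ⟨_, by simpa [smul_smul] using hsmul (1 / 2) _ u hu, rfl⟩
    have h2 : J ((1 / 2 : ℝ) • u) = 1 / 4 * J u := by
      simp only [hJ]
      rw [← integral_const_mul]
      refine integral_congr_ae (ae_of_all _ fun t => ?_)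
      simp only [Pi.smul_apply, map_smul, inner_smul_left, inner_smul_right, conj_trivial]
      ring
    rw [show (2⁻¹ : ℝ) = 1 / 2 by norm_num, h2] at h1
    linarith
  obtain ⟨P, hP, hPV⟩ := exists_selfAdjoint_of_parallelogram (fun x y => by
    refine le_antisymm ?_ (hge x y)
    -- The other half is the first one at `x + y` and `x - y`, combined with `V (2x) ≤ 4 V x`.
    have h1 := hge (x + y) (x - y)
    rw [show x + y + (x - y) = (2 : ℝ) • x by rw [two_smul]; abel,
      show x + y - (x - y) = (2 : ℝ) • y by rw [two_smul]; abel] at h1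
    linarith [hV2 x, hV2 y]) hbound
  exact ⟨P, hP, fun x => by rw [hPV]; exact hlub x⟩

end ValueFunction

/-! ### Semigroups, mild solutions and the integrated equation -/

section Semigroup

lemma intervalIntegrable_clm_comp {E F : Type*} [NormedAddCommGroup E] [NormedSpace ℝ E]
    [NormedAddCommGroup F] [NormedSpace ℝ F] (R : E →L[ℝ] F) {f : ℝ → E} {a b : ℝ}
    (hf : IntervalIntegrable f volume a b) :
    IntervalIntegrable (fun s => R (f s)) volume a b :=
  ⟨R.integrable_comp hf.1, R.integrable_comp hf.2⟩

variable {E : Type*} [NormedAddCommGroup E] [NormedSpace ℝ E] [CompleteSpace E]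
  {G : ℝ → E →L[ℝ] E}

lemma IsC0Semigroup.exists_bound (hG : IsC0Semigroup G) (T : ℝ) :
    ∃ M : ℝ, 0 ≤ M ∧ ∀ t ∈ Icc 0 T, ‖G t‖ ≤ M := by
  obtain ⟨M, hM⟩ := banach_steinhaus (g := fun t : Icc (0 : ℝ) T => G t) fun x => by
    obtain ⟨c, hc⟩ := (isCompact_Icc (a := (0 : ℝ)) (b := T)).exists_bound_of_continuousOn
      ((hG.continuousOn x).mono Icc_subset_Ici_self)
    exact ⟨c, fun t => hc t t.2⟩
  exact ⟨max M 0, le_max_right _ _, fun t ht => (hM ⟨t, ht⟩).trans (le_max_left _ _)⟩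

/-- Strong continuity and local boundedness together give joint continuity. Truncating time at zero
hides the arbitrary values at negative times, so that the function is continuous on all of `ℝ × E`.
-/
lemma IsC0Semigroup.continuous_uncurry (hG : IsC0Semigroup G) :
    Continuous fun p : ℝ × E => G (max p.1 0) p.2 := by
  rw [continuous_iff_continuousAt]
  rintro ⟨t₀, x₀⟩
  obtain ⟨M, hM0, hM⟩ := hG.exists_bound (max (t₀ + 1) 0)
  have h1 : Continuous fun t : ℝ => G (max t 0) x₀ :=
    (hG.continuousOn x₀).comp_continuous (by fun_prop) fun t => mem_Ici.2 (le_max_right _ _)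
  rw [ContinuousAt, tendsto_iff_norm_sub_tendsto_zero]
  have hlim : Tendsto (fun p : ℝ × E => M * ‖p.2 - x₀‖ + ‖G (max p.1 0) x₀ - G (max t₀ 0) x₀‖)
      (𝓝 (t₀, x₀)) (𝓝 0) := by
    have : Continuous fun p : ℝ × E =>
        M * ‖p.2 - x₀‖ + ‖G (max p.1 0) x₀ - G (max t₀ 0) x₀‖ := by
      have := h1.comp (continuous_fst (X := ℝ) (Y := E))
      exact (by fun_prop : Continuous fun p : ℝ × E => M * ‖p.2 - x₀‖).add
        (this.sub continuous_const).norm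
    simpa using this.tendsto (t₀, x₀)
  refine squeeze_zero' (Eventually.of_forall fun _ => norm_nonneg _) ?_ hlim
  have hev : ∀ᶠ p : ℝ × E in 𝓝 (t₀, x₀), p.1 < t₀ + 1 :=
    continuous_fst.continuousAt.eventually (Iio_mem_nhds (by simp))
  filter_upwards [hev] with p hp
  have e : G (max p.1 0) p.2 - G (max t₀ 0) x₀ =
      G (max p.1 0) (p.2 - x₀) + (G (max p.1 0) x₀ - G (max t₀ 0) x₀) := by
    rw [map_sub]; abel
  rw [e]
  refine (norm_add_le _ _).trans (add_le_add_left ((G (max p.1 0)).le_of_opNorm_le ?_ _) _)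
  exact hM _ ⟨le_max_right _ _, max_le_max hp.le le_rfl⟩

lemma IsC0Semigroup.continuous_orbit (hG : IsC0Semigroup G) (x : E) :
    Continuous fun t : ℝ => G (max t 0) x :=
  hG.continuous_uncurry.comp (by fun_prop : Continuous fun t : ℝ => (t, x))

lemma IsC0Semigroup.intervalIntegrable_convolution (hG : IsC0Semigroup G) {f : ℝ → E} {t : ℝ}
    (ht : 0 ≤ t) (hf : IntervalIntegrable f volume 0 t) :
    IntervalIntegrable (fun s => G (t - s) (f s)) volume 0 t := by
  rw [intervalIntegrable_iff_integrableOn_Ioc_of_le ht] at hf ⊢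
  obtain ⟨M, hM0, hM⟩ := hG.exists_bound t
  have h1 : AEStronglyMeasurable (fun s => G (max (t - s) 0) (f s))
      (volume.restrict (Ioc 0 t)) :=
    hG.continuous_uncurry.comp_aestronglyMeasurable
      ((Continuous.aestronglyMeasurable (by fun_prop : Continuous fun s : ℝ => t - s)).prodMk hf.1)
  refine (hf.norm.const_mul M).mono' (h1.congr ?_) ?_
  · filter_upwards [ae_restrict_mem measurableSet_Ioc] with s hs
    rw [max_eq_left (sub_nonneg.2 hs.2)]
  · filter_upwards [ae_restrict_mem measurableSet_Ioc] with s hs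
    exact (G (t - s)).le_of_opNorm_le (hM _ ⟨sub_nonneg.2 hs.2, by linarith [hs.1]⟩) _

/-- If `R` inverts the generator, then `R G(t) x = R x + ∫₀ᵗ G(s) x ds`. -/
lemma IsC0Semigroup.inverse_apply (hG : IsC0Semigroup G) {Γ : Submodule ℝ (E × E)}
    (hΓ : IsGeneratorGraph Γ G) {R : E →L[ℝ] E} (hR : ∀ x y, (x, y) ∈ Γ → R y = x) {t : ℝ}
    (ht : 0 ≤ t) (x : E) : R (G t x) = R x + ∫ s in (0 : ℝ)..t, G s x := by
  set g : ℝ → E := fun s => G (max s 0) x with hg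
  have hgc : Continuous g := hG.continuous_orbit x
  have hgi : ∀ a b, IntervalIntegrable g volume a b := fun a b => hgc.intervalIntegrable a b
  have e1 : ∫ s in (0 : ℝ)..t, G s x = ∫ s in (0 : ℝ)..t, g s := by
    refine intervalIntegral.integral_congr fun s hs => ?_
    rw [uIcc_of_le ht] at hs
    simp only [hg, max_eq_left hs.1]
  have hd : HasDerivAt (fun h => ∫ s in h..t + h, g s) (g t - g 0) 0 := by
    have ha : HasDerivAt (fun h : ℝ => ∫ s in (0 : ℝ)..t + h, g s) (g t) 0 := by
      have := (hgc.integral_hasStrictDerivAt 0 (t + 0)).hasDerivAt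
      simpa using this.comp_const_add t 0
    have hb : HasDerivAt (fun h : ℝ => ∫ s in (0 : ℝ)..h, g s) (g 0) 0 :=
      (hgc.integral_hasStrictDerivAt 0 0).hasDerivAt
    refine (ha.sub hb).congr_of_eventuallyEq (Eventually.of_forall fun h => ?_)
    exact (intervalIntegral.integral_interval_sub_left (hgi _ _) (hgi _ _)).symm
  -- For `h > 0`, `G h` shifts the interval of integration by `h`, so the difference quotient of the
  -- semigroup at this integral is that of `h ↦ ∫_h^{t+h} g`.
  have hmem : (∫ s in (0 : ℝ)..t, g s, g t - g 0) ∈ Γ := by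
    refine (hΓ _ _).2 (hd.tendsto_slope_zero_right.congr' ?_)
    filter_upwards [self_mem_nhdsWithin] with h hh
    have hh0 : (0 : ℝ) ≤ h := le_of_lt hh
    rw [zero_add, add_zero, ← (G h).intervalIntegral_comp_comm (hgi _ _)]
    congr 2
    have : ∫ s in (0 : ℝ)..t, G h (g s) = ∫ s in (0 : ℝ)..t, g (s + h) := by
      refine intervalIntegral.integral_congr fun s hs => ?_
      rw [uIcc_of_le ht] at hs
      simp only [hg]
      rw [max_eq_left hs.1, max_eq_left (add_nonneg hs.1 hh0), add_comm s h,
        hG.map_add h s hh0 hs.1]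
      rfl
    rw [this, intervalIntegral.integral_comp_add_right, zero_add]
  have hfin := hR _ _ hmem
  rw [e1, ← hfin, map_sub]
  simp [hg, max_eq_left ht, hG.map_zero]

/-- Mild solutions satisfy the integrated equation `R u(t) = R x + ∫₀ᵗ (u + R f)`, where `R`
inverts the generator. -/
lemma IsC0Semigroup.inverse_mild (hG : IsC0Semigroup G) {Γ : Submodule ℝ (E × E)}
    (hΓ : IsGeneratorGraph Γ G) {R : E →L[ℝ] E} (hR : ∀ x y, (x, y) ∈ Γ → R y = x) {t : ℝ}
    (ht : 0 ≤ t) (x : E) {f : ℝ → E} (hf : IntervalIntegrable f volume 0 t) :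
    R (G t x + ∫ s in (0 : ℝ)..t, G (t - s) (f s)) = R x + ∫ r in (0 : ℝ)..t,
      ((G r x + ∫ s in (0 : ℝ)..r, G (r - s) (f s)) + R (f r)) := by
  have hf' := (intervalIntegrable_iff_integrableOn_Ioc_of_le ht).1 hf
  set μ : Measure ℝ := volume.restrict (Ioc 0 t) with hμ
  have hf'' : Integrable f μ := hf'
  obtain ⟨M, hM0, hM⟩ := hG.exists_bound t
  -- Fubini on `s ≤ r`: integrating `G(r - s) f(s)` over `r ∈ [s, t]` and using `inverse_apply`
  -- gives `R G(t - s) f(s) - R f(s)`.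
  set k : ℝ × ℝ → E :=
    {p : ℝ × ℝ | p.2 ≤ p.1}.indicator fun p => G (max (p.1 - p.2) 0) (f p.2) with hkdef
  have hkm : AEStronglyMeasurable k (μ.prod μ) := by
    refine AEStronglyMeasurable.indicator ?_ (measurableSet_le measurable_snd measurable_fst)
    exact hG.continuous_uncurry.comp_aestronglyMeasurable ((Continuous.aestronglyMeasurable
      (by fun_prop : Continuous fun p : ℝ × ℝ => p.1 - p.2)).prodMk hf''.1.comp_snd)
  have hmem : ∀ᵐ p ∂(μ.prod μ), p.1 ∈ Ioc 0 t ∧ p.2 ∈ Ioc 0 t := by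
    rw [hμ, Measure.prod_restrict]
    exact ae_restrict_mem (measurableSet_Ioc.prod measurableSet_Ioc)
  have hk : Integrable k (μ.prod μ) := by
    refine ((hf''.norm.const_mul M).comp_snd μ).mono' hkm ?_
    filter_upwards [hmem] with p hp
    simp only [hkdef, indicator]
    split_ifs with h
    · refine (G _).le_of_opNorm_le (hM _ ⟨le_max_right _ _, max_le ?_ ht⟩) _
      linarith [hp.1.2, hp.2.1]
    · rw [norm_zero]; positivity
  have hint1 : ∀ r ∈ Ioc 0 t, ∫ s, k (r, s) ∂μ = ∫ s in (0 : ℝ)..r, G (r - s) (f s) := by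
    intro r hr
    have e : (fun s => k (r, s)) = (Iic r).indicator fun s => G (r - s) (f s) := by
      ext s
      simp only [hkdef, indicator, mem_ofPred_eq, mem_Iic]
      split_ifs with h
      · rw [max_eq_left (sub_nonneg.2 h)]
      · rfl
    rw [e, integral_indicator measurableSet_Iic, hμ, Measure.restrict_restrict measurableSet_Iic,
      intervalIntegral.integral_of_le hr.1.le]
    congr 2
    ext s
    simp only [mem_inter_iff, mem_Iic, mem_Ioc]
    exact ⟨fun h => ⟨h.2.1, h.1⟩, fun h => ⟨h.2, h.1, h.2.trans hr.2⟩⟩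
  have hint2 : ∀ s ∈ Ioc 0 t, ∫ r, k (r, s) ∂μ = R (G (t - s) (f s)) - R (f s) := by
    intro s hs
    have e : (fun r => k (r, s)) = (Ici s).indicator fun r => G (r - s) (f s) := by
      ext r
      simp only [hkdef, indicator, mem_ofPred_eq, mem_Ici]
      split_ifs with h
      · rw [max_eq_left (sub_nonneg.2 h)]
      · rfl
    have e2 : Ici s ∩ Ioc 0 t = Icc s t := by
      ext r
      simp only [mem_inter_iff, mem_Ici, mem_Ioc, mem_Icc]
      exact ⟨fun h => ⟨h.1, h.2.2⟩, fun h => ⟨h.1, hs.1.trans_le h.1, h.2⟩⟩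
    rw [e, integral_indicator measurableSet_Ici, hμ, Measure.restrict_restrict measurableSet_Ici,
      e2, integral_Icc_eq_integral_Ioc, ← intervalIntegral.integral_of_le hs.2,
      intervalIntegral.integral_comp_sub_right (fun r => G r (f s)) s, sub_self,
      hG.inverse_apply hΓ hR (sub_nonneg.2 hs.2), add_sub_cancel_left]
  have hswap := integral_integral_swap (f := fun r s => k (r, s)) hk
  have e1 : ∫ r, ∫ s, k (r, s) ∂μ ∂μ = ∫ r in (0 : ℝ)..t, ∫ s in (0 : ℝ)..r, G (r - s) (f s) := by
    rw [intervalIntegral.integral_of_le ht]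
    exact setIntegral_congr_fun measurableSet_Ioc hint1
  have hconv := hG.intervalIntegrable_convolution ht hf
  have e2 : ∫ s, ∫ r, k (r, s) ∂μ ∂μ =
      R (∫ s in (0 : ℝ)..t, G (t - s) (f s)) - ∫ s in (0 : ℝ)..t, R (f s) := by
    rw [← R.intervalIntegral_comp_comm hconv, ← intervalIntegral.integral_sub
      (intervalIntegrable_clm_comp R hconv) (intervalIntegrable_clm_comp R hf),
      intervalIntegral.integral_of_le ht]
    exact setIntegral_congr_fun measurableSet_Ioc hint2
  have i1 : IntervalIntegrable (fun r => G r x) volume 0 t :=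
    ContinuousOn.intervalIntegrable_of_Icc ht ((hG.continuousOn x).mono Icc_subset_Ici_self)
  have i2 : IntervalIntegrable (fun r => ∫ s in (0 : ℝ)..r, G (r - s) (f s)) volume 0 t := by
    rw [intervalIntegrable_iff_integrableOn_Ioc_of_le ht]
    refine hk.integral_prod_left.congr ?_
    filter_upwards [ae_restrict_mem measurableSet_Ioc] with r hr
    exact hint1 r hr
  rw [intervalIntegral.integral_add (i1.add i2) (intervalIntegrable_clm_comp R hf),
    intervalIntegral.integral_add i1 i2, _root_.map_add, hG.inverse_apply hΓ hR ht, ← e1, hswap, e2]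
  abel

end Semigroup

/-! ### Resolvents of the complexified generator -/

section Resolvent

lemma isResolventAt_unboundedResolvent {E : Type*} [NormedAddCommGroup E] [NormedSpace ℂ E]
    {A : E →ₗ.[ℂ] E} {z : ℂ} (hz : z ∈ unboundedResolventSet A) :
    IsResolventAt A z (unboundedResolvent A z) := by
  rw [unboundedResolvent, dif_pos hz]
  exact hz.choose_spec

variable {H V : Type*} [NormedAddCommGroup H] [InnerProductSpace ℝ H]
  [NormedAddCommGroup V] [InnerProductSpace ℝ V]
  {j : V →L[ℝ] H} {A : H →ₗ.[ℝ] H}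

lemma complexify_injective (hj : Function.Injective j) : Function.Injective (complexify j) := by
  intro x y hxy
  exact Cx.ext (hj (congrArg Cx.re hxy)) (hj (congrArg Cx.im hxy))

/-- A vector `x` lies in `D(A) + i D(A)` with `A x = y` if this holds for real and imaginary
parts. -/
lemma exists_complexifyPMap_eq {x y : Cx H} (hre : (x.re, y.re) ∈ A.graph)
    (him : (x.im, y.im) ∈ A.graph) :
    ∃ h : x ∈ (complexifyPMap A).domain, complexifyPMap A ⟨x, h⟩ = y := by
  rw [LinearPMap.mem_graph_iff] at hre him
  obtain ⟨⟨a, ha⟩, rfl, h1⟩ := hre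
  obtain ⟨⟨b, hb⟩, hbx, h2⟩ := him
  simp only at hbx
  subst hbx
  exact ⟨⟨ha, hb⟩, Cx.ext h1 h2⟩

lemma graph_of_complexifyPMap_eq {x y : Cx H} (h : x ∈ (complexifyPMap A).domain)
    (hxy : complexifyPMap A ⟨x, h⟩ = y) : (x.re, y.re) ∈ A.graph ∧ (x.im, y.im) ∈ A.graph := by
  subst hxy
  exact ⟨A.mem_graph ⟨x.re, h.1⟩, A.mem_graph ⟨x.im, h.2⟩⟩

/-- Condition (RES) at the frequency zero gives a bounded inverse of the real operator `A`. -/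
lemma RES.exists_inverse (hRES : RES (complexify j) (complexifyPMap A)) :
    ∃ S : H →L[ℝ] V, (∀ y, (j (S y), y) ∈ A.graph) ∧ ∀ x y, (x, y) ∈ A.graph → j (S y) = x := by
  obtain ⟨h1, M, hM⟩ := hRES
  obtain ⟨R, hR, -⟩ := hM 0
  have hres := isResolventAt_unboundedResolvent (h1 0)
  rw [show ((0 : ℝ) : ℂ) * Complex.I = 0 by simp] at hR hres
  have hjR : ∀ y, complexify j (R y) = unboundedResolvent (complexifyPMap A) 0 y :=
    fun y => DFunLike.congr_fun hR y
  refine ⟨Cx.reL ∘L (R.restrictScalars ℝ) ∘L Cx.ofRealL, fun y => ?_, fun x y hxy => ?_⟩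
  · obtain ⟨h, e⟩ := hres.1 (Cx.ofRealL y)
    rw [zero_smul, sub_zero] at e
    have := (graph_of_complexifyPMap_eq h e).1
    rw [← hjR] at this
    exact this
  · obtain ⟨h, e⟩ := exists_complexifyPMap_eq (x := Cx.ofRealL x) (y := Cx.ofRealL y) hxy
      (by simp)
    have := hres.2 ⟨_, h⟩
    rw [e, zero_smul, sub_zero, ← hjR] at this
    exact congrArg Cx.re this

/-- Solutions of the integrated equation at the frequency `ω` are given by the resolvent. -/
lemma eq_neg_resolvent_of_frequency {S : H →L[ℝ] V} (hS : ∀ y, (j (S y), y) ∈ A.graph) {ω : ℝ}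
    (hω : (ω : ℂ) * Complex.I ∈ unboundedResolventSet (complexifyPMap A)) {v : Cx V} {f : Cx H}
    (h : ((ω : ℂ) * Complex.I) • complexify (j ∘L S) (complexify j v) =
      complexify j v + complexify (j ∘L S) f) :
    complexify j v = -unboundedResolvent (complexifyPMap A) ((ω : ℂ) * Complex.I) f := by
  -- This is the value of `A v`: the hypothesis reads `v = A⁻¹ (iω v - f)`, whence `v ∈ D(A)` and
  -- `(A - iω) v = -f`.
  set u := ((ω : ℂ) * Complex.I) • complexify j v - f with hu
  have hv : complexify j v = complexify (j ∘L S) u := by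
    rw [hu, map_sub, map_smul, h, add_sub_cancel_right]
  obtain ⟨hd, he⟩ := exists_complexifyPMap_eq (A := A) (x := complexify j v) (y := u)
    (by rw [hv]; exact hS _) (by rw [hv]; exact hS _)
  have := (isResolventAt_unboundedResolvent hω).2 ⟨_, hd⟩
  rw [he] at this
  rw [← map_neg]
  refine this.symm.trans (congrArg _ ?_)
  rw [hu]
  abel

end Resolvent

/-! ### Relaxing the control: the penalised frequency inequality -/

section FrequencyAlgebra

variable {V Ξ H : Type*} [NormedAddCommGroup V] [InnerProductSpace ℝ V]
  [NormedAddCommGroup Ξ] [InnerProductSpace ℝ Ξ] [NormedAddCommGroup H] [InnerProductSpace ℝ H]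
  (F₁ : V →L[ℝ] V) (F₂ : V →L[ℝ] Ξ) (F₃ : Ξ →L[ℝ] Ξ)

/-- Young's inequality: a perturbation `w` of the state costs an arbitrarily small part of `‖v‖² +
‖ξ‖²` and a large multiple of `‖w‖²`. Below, `w` is the response to `f - B ξ`, so the large multiple
is absorbed by the penalty. -/
lemma quadForm_add_le {ε : ℝ} (hε : 0 < ε) : ∃ c : ℝ, 0 ≤ c ∧ ∀ (v w : V) (ξ : Ξ),
    quadForm F₁ F₂ F₃ (v + w) ξ ≤
      quadForm F₁ F₂ F₃ v ξ + ε * (‖v‖ ^ 2 + ‖ξ‖ ^ 2) + c * ‖w‖ ^ 2 := by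
  refine ⟨‖F₁‖ ^ 2 / ε + ‖F₁‖ + ‖F₂‖ ^ 2 / ε, by positivity, fun v w ξ => ?_⟩
  have young : ∀ a x y : ℝ, 2 * (a * x * y) ≤ ε * x ^ 2 + a ^ 2 / ε * y ^ 2 := fun a x y => by
    have h : 0 ≤ (ε * x - a * y) ^ 2 / ε := by positivity
    have e : (ε * x - a * y) ^ 2 / ε = ε * x ^ 2 + a ^ 2 / ε * y ^ 2 - 2 * (a * x * y) := by
      field_simp; ring
    linarith
  have h₁ : ∀ a b : V, inner ℝ (F₁ a) b ≤ ‖F₁‖ * ‖a‖ * ‖b‖ := fun a b =>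
    (real_inner_le_norm _ _).trans (by gcongr; exact F₁.le_opNorm a)
  have h₂ : inner ℝ (F₂ w) ξ ≤ ‖F₂‖ * ‖w‖ * ‖ξ‖ :=
    (real_inner_le_norm _ _).trans (by gcongr; exact F₂.le_opNorm w)
  have y₁ := young ‖F₁‖ ‖v‖ ‖w‖
  have y₂ := young ‖F₂‖ ‖ξ‖ ‖w‖
  simp only [quadForm, map_add, inner_add_left, inner_add_right]
  linarith [h₁ v w, h₁ w v, h₁ w w, mul_right_comm ‖F₁‖ ‖w‖ ‖v‖, mul_right_comm ‖F₂‖ ‖w‖ ‖ξ‖]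

lemma hermExt_quadForm_add_le {ε : ℝ} (hε : 0 < ε) : ∃ c : ℝ, 0 ≤ c ∧
    ∀ (v w : Cx V) (ξ : Cx Ξ), hermExt (quadForm F₁ F₂ F₃) (v + w) ξ ≤
      hermExt (quadForm F₁ F₂ F₃) v ξ + ε * (‖v‖ ^ 2 + ‖ξ‖ ^ 2) + c * ‖w‖ ^ 2 := by
  obtain ⟨c, hc, h⟩ := quadForm_add_le F₁ F₂ F₃ hε
  refine ⟨c, hc, fun v w ξ => ?_⟩
  have h1 := h v.re w.re ξ.re
  have h2 := h v.im w.im ξ.im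
  simp only [hermExt, Cx.norm_sq, Cx.re_add, Cx.im_add]
  linarith

/-- Penalizing an additional control makes the frequency inequality coercive for the extended
system. -/
lemma exists_extended_frequency_inequality {j : V →L[ℝ] H} (hj : Function.Injective j)
    {A : H →ₗ.[ℝ] H} (hRES : RES (complexify j) (complexifyPMap A)) (B : Ξ →L[ℝ] H)
    (hF : FrequencyInequality (complexify j) (complexifyPMap A) (complexify B)
      (hermExt (quadForm F₁ F₂ F₃))) :
    ∃ N δ : ℝ, 0 < δ ∧ ∀ (ω : ℝ) (v : Cx V) (ξ : Cx Ξ) (f : Cx H),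
      complexify j v = -unboundedResolvent (complexifyPMap A) ((ω : ℂ) * Complex.I) f →
      hermExt (quadForm F₁ F₂ F₃) v ξ - N * ‖f - complexify B ξ‖ ^ 2 ≤
        -(2 * δ) * (‖v‖ ^ 2 + ‖ξ‖ ^ 2 + ‖f‖ ^ 2) := by
  obtain ⟨-, M, hM⟩ := hRES
  obtain ⟨δ', hδ', hF⟩ := hF
  set b : ℝ := ‖complexify B‖
  -- Chosen so that the Young error, with `‖R B ξ‖ ≤ M b ‖ξ‖`, consumes at most half of the margin
  -- `δ' ‖ξ‖²`.
  set ε : ℝ := δ' / (2 * ((M * b) ^ 2 + 1)) with hεdef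
  have hε : 0 < ε := by positivity
  obtain ⟨c, hc, hadd⟩ := hermExt_quadForm_add_le F₁ F₂ F₃ hε
  set K : ℝ := 1 + (1 + M ^ 2) * (2 + 2 * b ^ 2) with hK
  have hK0 : 0 < K := by positivity
  set m : ℝ := min (δ' / 2) 1
  have hm : 0 < m := by positivity
  -- In the penalty, `c M²` pays for the perturbation `R g` and the extra `1` leaves coercivity in
  -- `g = f - B ξ`. The constant `K` bounds `‖v‖² + ‖ξ‖² + ‖f‖²` in terms of `‖ξ‖² + ‖g‖²`. The
  -- margin is written as `2δ` because it is spent twice: once inside the cost and once for its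
  -- coercivity.
  refine ⟨c * M ^ 2 + 1, m / (2 * K), by positivity, fun ω v ξ f hv => ?_⟩
  obtain ⟨R, hR, hRM⟩ := hM ω
  have hjR : ∀ y, complexify j (R y) =
      unboundedResolvent (complexifyPMap A) ((ω : ℂ) * Complex.I) y :=
    fun y => DFunLike.congr_fun hR y
  have hvR : v = -R f := complexify_injective hj (by rw [hv, map_neg, hjR])
  have hRb : ∀ y, ‖R y‖ ≤ M * ‖y‖ := fun y => R.le_of_opNorm_le hRM y
  set g := f - complexify B ξ with hg
  have hsplit : v = -R (complexify B ξ) + -R g := by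
    rw [hvR, hg, map_sub]; abel
  have h1 := hF ω ξ (-R (complexify B ξ)) (by rw [map_neg, hjR])
  have h2 := hadd (-R (complexify B ξ)) (-R g) ξ
  rw [← hsplit, norm_neg, norm_neg] at h2
  have sq : ∀ y, ‖R y‖ ^ 2 ≤ M ^ 2 * ‖y‖ ^ 2 := fun y => by
    rw [← mul_pow]; exact pow_le_pow_left₀ (norm_nonneg _) (hRb y) 2
  have hBξ : ‖complexify B ξ‖ ^ 2 ≤ b ^ 2 * ‖ξ‖ ^ 2 := by
    rw [← mul_pow]; exact pow_le_pow_left₀ (norm_nonneg _) ((complexify B).le_opNorm ξ) 2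
  have h3 : ‖R (complexify B ξ)‖ ^ 2 ≤ (M * b) ^ 2 * ‖ξ‖ ^ 2 := by
    refine (sq _).trans ?_
    rw [mul_pow, mul_assoc]
    exact mul_le_mul_of_nonneg_left hBξ (by positivity)
  have h4 : ε * (‖R (complexify B ξ)‖ ^ 2 + ‖ξ‖ ^ 2) ≤ δ' / 2 * ‖ξ‖ ^ 2 := by
    have : δ' / 2 * ‖ξ‖ ^ 2 = ε * ((M * b) ^ 2 * ‖ξ‖ ^ 2 + ‖ξ‖ ^ 2) := by
      rw [hεdef]; field_simp
    rw [this]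
    gcongr
  have h5 : c * ‖R g‖ ^ 2 ≤ c * M ^ 2 * ‖g‖ ^ 2 := by
    rw [mul_assoc]; exact mul_le_mul_of_nonneg_left (sq g) hc
  have h6 : ‖f‖ ^ 2 ≤ 2 * ‖g‖ ^ 2 + 2 * (b ^ 2 * ‖ξ‖ ^ 2) := by
    have hf : f = g + complexify B ξ := by rw [hg]; abel
    have : ‖f‖ ≤ ‖g‖ + ‖complexify B ξ‖ := by
      conv_lhs => rw [hf]
      exact norm_add_le _ _
    nlinarith [sq_nonneg (‖g‖ - ‖complexify B ξ‖), norm_nonneg f]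
  have h7 : ‖v‖ ^ 2 ≤ M ^ 2 * ‖f‖ ^ 2 := by rw [hvR, norm_neg]; exact sq f
  have h8 : ‖v‖ ^ 2 + ‖ξ‖ ^ 2 + ‖f‖ ^ 2 ≤ K * (‖ξ‖ ^ 2 + ‖g‖ ^ 2) := by
    have h9 : (1 + M ^ 2) * ‖f‖ ^ 2 ≤ (1 + M ^ 2) * (2 * ‖g‖ ^ 2 + 2 * (b ^ 2 * ‖ξ‖ ^ 2)) :=
      mul_le_mul_of_nonneg_left h6 (by positivity)
    have h10 : (0 : ℝ) ≤ ‖g‖ ^ 2 + (1 + M ^ 2) * (2 * ‖ξ‖ ^ 2 + 2 * b ^ 2 * ‖g‖ ^ 2) := by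
      positivity
    rw [hK]
    linarith
  have h11 : 2 * (m / (2 * K)) * (‖v‖ ^ 2 + ‖ξ‖ ^ 2 + ‖f‖ ^ 2) ≤ m * (‖ξ‖ ^ 2 + ‖g‖ ^ 2) := by
    have e : m * (‖ξ‖ ^ 2 + ‖g‖ ^ 2) = 2 * (m / (2 * K)) * (K * (‖ξ‖ ^ 2 + ‖g‖ ^ 2)) := by
      field_simp
    rw [e]
    exact mul_le_mul_of_nonneg_left h8 (by positivity)
  have h12 : m * ‖ξ‖ ^ 2 ≤ δ' / 2 * ‖ξ‖ ^ 2 := by gcongr; exact min_le_left _ _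
  have h13 : m * ‖g‖ ^ 2 ≤ 1 * ‖g‖ ^ 2 := by gcongr; exact min_le_right _ _
  linarith

end FrequencyAlgebra

/-! ### The relaxed system: cost, trajectories and coercivity -/

/-- Triples of a state, a control and a source term. -/
abbrev ExtState (V Ξ H : Type*) := WithLp 2 (V × WithLp 2 (Ξ × H))

namespace ExtState

variable {V Ξ H : Type*} [NormedAddCommGroup V] [InnerProductSpace ℝ V]
  [NormedAddCommGroup Ξ] [InnerProductSpace ℝ Ξ] [NormedAddCommGroup H] [InnerProductSpace ℝ H]

variable (V Ξ H) in
/-- The state component. -/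
def state : ExtState V Ξ H →L[ℝ] V := WithLp.fstL 2 ℝ _ _

variable (V Ξ H) in
/-- The control component. -/
def control : ExtState V Ξ H →L[ℝ] Ξ := WithLp.fstL 2 ℝ _ _ ∘L WithLp.sndL 2 ℝ _ _

variable (V Ξ H) in
/-- The source component. -/
def source : ExtState V Ξ H →L[ℝ] H := WithLp.sndL 2 ℝ _ _ ∘L WithLp.sndL 2 ℝ _ _

variable (V Ξ H) in
/-- The linear map assembling a triple from its components. -/
def ofProd : V × Ξ × H →L[ℝ] ExtState V Ξ H :=
  (WithLp.prodContinuousLinearEquiv 2 ℝ V (WithLp 2 (Ξ × H))).symm.toContinuousLinearMap ∘L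
    (ContinuousLinearMap.id ℝ V).prodMap
      (WithLp.prodContinuousLinearEquiv 2 ℝ Ξ H).symm.toContinuousLinearMap

@[simp] lemma state_ofProd (p : V × Ξ × H) : state V Ξ H (ofProd V Ξ H p) = p.1 := rfl
@[simp] lemma control_ofProd (p : V × Ξ × H) : control V Ξ H (ofProd V Ξ H p) = p.2.1 := rfl
@[simp] lemma source_ofProd (p : V × Ξ × H) : source V Ξ H (ofProd V Ξ H p) = p.2.2 := rfl

lemma norm_sq (z : ExtState V Ξ H) :
    ‖z‖ ^ 2 = ‖state V Ξ H z‖ ^ 2 + ‖control V Ξ H z‖ ^ 2 + ‖source V Ξ H z‖ ^ 2 := by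
  rw [WithLp.prod_norm_sq_eq_of_L2, WithLp.prod_norm_sq_eq_of_L2, ← add_assoc]
  rfl

lemma memLp_ofProd {α : Type*} [MeasurableSpace α] {μ : Measure α} {v : α → V} {ξ : α → Ξ}
    {f : α → H} (hv : MemLp v 2 μ) (hξ : MemLp ξ 2 μ) (hf : MemLp f 2 μ) :
    MemLp (fun t => ofProd V Ξ H (v t, ξ t, f t)) 2 μ :=
  (ofProd V Ξ H).comp_memLp' (MemLp.of_fst_snd ⟨hv, MemLp.of_fst_snd ⟨hξ, hf⟩⟩)

variable (F₁ : V →L[ℝ] V) (F₂ : V →L[ℝ] Ξ) (F₃ : Ξ →L[ℝ] Ξ) (B : Ξ →L[ℝ] H) (N δ : ℝ)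

section Cost

variable [CompleteSpace V] [CompleteSpace Ξ] [CompleteSpace H]

/-- The operator of the quadratic form
`F(v, ξ) - N |f - B ξ|² + δ (|v|² + |ξ|²)`. -/
def costOp : ExtState V Ξ H →L[ℝ] ExtState V Ξ H :=
  (state V Ξ H).adjoint ∘L (F₁ ∘L state V Ξ H + δ • state V Ξ H) +
    (control V Ξ H).adjoint ∘L
      ((2 : ℝ) • F₂ ∘L state V Ξ H + F₃ ∘L control V Ξ H + δ • control V Ξ H) -
    N • (source V Ξ H - B ∘L control V Ξ H).adjoint ∘L (source V Ξ H - B ∘L control V Ξ H)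

/-- Only the diagonal values of the form matter, so in `costOp` the mixed term of `F` sits entirely
on the control side instead of being symmetrised. -/
lemma inner_costOp (z : ExtState V Ξ H) : inner ℝ (costOp F₁ F₂ F₃ B N δ z) z =
    quadForm F₁ F₂ F₃ (state V Ξ H z) (control V Ξ H z)
      - N * ‖source V Ξ H z - B (control V Ξ H z)‖ ^ 2
      + δ * (‖state V Ξ H z‖ ^ 2 + ‖control V Ξ H z‖ ^ 2) := by
  have h1 : ∀ x, inner ℝ ((state V Ξ H).adjoint x) z = inner ℝ x (state V Ξ H z) :=
    fun x => ContinuousLinearMap.adjoint_inner_left _ _ _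
  have h2 : ∀ x, inner ℝ ((control V Ξ H).adjoint x) z = inner ℝ x (control V Ξ H z) :=
    fun x => ContinuousLinearMap.adjoint_inner_left _ _ _
  have h3 : ∀ x, inner ℝ ((source V Ξ H - B ∘L control V Ξ H).adjoint x) z =
      inner ℝ x (source V Ξ H z - B (control V Ξ H z)) :=
    fun x => ContinuousLinearMap.adjoint_inner_left _ _ _
  simp only [costOp, add_apply, sub_apply, smul_apply, ContinuousLinearMap.comp_apply, inner_add_left,
    inner_sub_left, inner_smul_left, h1, h2, conj_trivial]
  rw [h3, real_inner_self_eq_norm_sq, real_inner_self_eq_norm_sq, real_inner_self_eq_norm_sq,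
    quadForm]
  ring

end Cost

variable (Ξ) in
/-- The operator `(v, ξ, f) ↦ S v` of the integrated equation `S v = S v₀ + ∫ (v + S f)`. -/
def leftOp (j : V →L[ℝ] H) (S : H →L[ℝ] V) : ExtState V Ξ H →L[ℝ] H :=
  j ∘L S ∘L j ∘L state V Ξ H

variable (Ξ) in
/-- The operator `(v, ξ, f) ↦ v + S f` of the integrated equation `S v = S v₀ + ∫ (v + S f)`. -/
def rightOp (j : V →L[ℝ] H) (S : H →L[ℝ] V) : ExtState V Ξ H →L[ℝ] H :=
  j ∘L state V Ξ H + j ∘L S ∘L source V Ξ H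

variable (Ξ) in
/-- Square integrable solutions of the integrated equation starting at `x`. -/
def trajectories (j : V →L[ℝ] H) (S : H →L[ℝ] V) (x : V) : Set (ℝ → ExtState V Ξ H) :=
  {z | MemLp z 2 (volume.restrict (Ioi 0)) ∧ ∀ t, 0 ≤ t →
    leftOp Ξ j S (z t) = j (S (j x)) + ∫ s in (0 : ℝ)..t, rightOp Ξ j S (z s)}

variable {j : V →L[ℝ] H} {S : H →L[ℝ] V}

lemma intervalIntegrable_clm_of_memLp {Z F : Type*} [NormedAddCommGroup Z] [NormedSpace ℝ Z]
    [NormedAddCommGroup F] [NormedSpace ℝ F] (D : Z →L[ℝ] F) {z : ℝ → Z}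
    (hz : MemLp z 2 (volume.restrict (Ioi 0))) {t : ℝ} (ht : 0 ≤ t) :
    IntervalIntegrable (fun s => D (z s)) volume 0 t := by
  rw [intervalIntegrable_iff_integrableOn_Ioc_of_le ht]
  exact (D.comp_memLp'
    (hz.mono_measure (Measure.restrict_mono Ioc_subset_Ioi_self le_rfl))).integrable (by norm_num)

lemma add_mem_trajectories {x y : V} {z w : ℝ → ExtState V Ξ H} (hz : z ∈ trajectories Ξ j S x)
    (hw : w ∈ trajectories Ξ j S y) : z + w ∈ trajectories Ξ j S (x + y) := by
  refine ⟨hz.1.add hw.1, fun t ht => ?_⟩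
  simp only [Pi.add_apply, map_add]
  rw [hz.2 t ht, hw.2 t ht, intervalIntegral.integral_add
    (intervalIntegrable_clm_of_memLp _ hz.1 ht) (intervalIntegrable_clm_of_memLp _ hw.1 ht)]
  abel

lemma smul_mem_trajectories (r : ℝ) {x : V} {z : ℝ → ExtState V Ξ H}
    (hz : z ∈ trajectories Ξ j S x) : r • z ∈ trajectories Ξ j S (r • x) := by
  refine ⟨hz.1.const_smul r, fun t ht => ?_⟩
  simp only [Pi.smul_apply, map_smul]
  rw [hz.2 t ht, intervalIntegral.integral_smul, smul_add]

variable [CompleteSpace V] [CompleteSpace Ξ] [CompleteSpace H]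

/-- The equation `iω C ζ = D ζ` for the relaxed system says that the state is minus the resolvent
applied to the source. The penalised frequency inequality thus makes the cost plus `δ ‖z‖²`
non-positive in the frequency domain, and `integral_quadratic_nonpos` transfers this to
trajectories. -/
lemma coercive_of_frequency {A : H →ₗ.[ℝ] H} (hS : ∀ y, (j (S y), y) ∈ A.graph)
    (hspec : ∀ ω : ℝ, (ω : ℂ) * Complex.I ∈ unboundedResolventSet (complexifyPMap A))
    (hfreq : ∀ (ω : ℝ) (v : Cx V) (ξ : Cx Ξ) (f : Cx H),
      complexify j v = -unboundedResolvent (complexifyPMap A) ((ω : ℂ) * Complex.I) f →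
      hermExt (quadForm F₁ F₂ F₃) v ξ - N * ‖f - complexify B ξ‖ ^ 2 ≤
        -(2 * δ) * (‖v‖ ^ 2 + ‖ξ‖ ^ 2 + ‖f‖ ^ 2)) (hδ : 0 ≤ δ)
    {z : ℝ → ExtState V Ξ H} (hz : z ∈ trajectories Ξ j S 0) :
    ∫ t in Ioi (0 : ℝ), inner ℝ (costOp F₁ F₂ F₃ B N δ (z t)) (z t) ≤
      -δ * ∫ t in Ioi (0 : ℝ), ‖z t‖ ^ 2 := by
  -- `E` copies the state into the source slot. Damping by `exp(-ε t)` adds `-ε v` to the source,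
  -- and `1 - ε E` is precisely this correction.
  set E : ExtState V Ξ H →L[ℝ] ExtState V Ξ H :=
    ofProd V Ξ H ∘L ContinuousLinearMap.inr ℝ V (Ξ × H) ∘L ContinuousLinearMap.inr ℝ Ξ H ∘L
      j ∘L state V Ξ H
  set Q := costOp F₁ F₂ F₃ B N δ + δ • ContinuousLinearMap.id ℝ (ExtState V Ξ H) with hQ
  have hQz : ∀ z : ExtState V Ξ H, inner ℝ (Q z) z =
      inner ℝ (costOp F₁ F₂ F₃ B N δ z) z + δ * ‖z‖ ^ 2 := fun z => by
    simp [hQ, inner_add_left, inner_smul_left]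
  have key := integral_quadratic_nonpos (leftOp Ξ j S) (rightOp Ξ j S) E Q
    (by ext; simp [leftOp, E]) (by ext; simp [leftOp, rightOp, E]) ?_ hz.1
    (fun t ht => by rw [hz.2 t ht]; simp)
  · have i1 := integrable_inner_clm (costOp F₁ F₂ F₃ B N δ) hz.1
    have i2 := (hz.1.integrable_norm_pow two_ne_zero).const_mul δ
    simp only [hQz] at key
    rw [integral_add i1 i2, integral_const_mul] at key
    linarith
  · intro ω ζ hζ
    have h1 := eq_neg_resolvent_of_frequency (v := complexify (state V Ξ H) ζ)
      (f := complexify (source V Ξ H) ζ) hS (hspec ω) (by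
        convert! hζ using 1)
    have h2 := hfreq ω _ (complexify (control V Ξ H) ζ) _ h1
    simp only [hQz, inner_costOp, norm_sq]
    simp only [hermExt, Cx.norm_sq, re_complexify, im_complexify] at h2
    simp only [Cx.re_sub, Cx.im_sub, re_complexify, im_complexify] at h2
    nlinarith [mul_nonneg hδ (sq_nonneg ‖source V Ξ H ζ.re‖),
      mul_nonneg hδ (sq_nonneg ‖source V Ξ H ζ.im‖)]

end ExtState

/-! ### Steering to zero and concatenation of trajectories -/

namespace ExtState

section Concat

variable {V Ξ H : Type*} [NormedAddCommGroup V] [NormedAddCommGroup Ξ] [NormedAddCommGroup H]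

/-- Concatenation of a solution on `[0, T]` with a trajectory starting at its end point. -/
def concat (T : ℝ) (a z : ℝ → ExtState V Ξ H) (t : ℝ) : ExtState V Ξ H :=
  (Icc 0 T).indicator a t + (Ioi 0).indicator z (t - T)

lemma concat_of_le {T : ℝ} {a z : ℝ → ExtState V Ξ H} {t : ℝ} (ht : t ∈ Icc 0 T) :
    concat T a z t = a t := by
  rw [concat, indicator_of_mem ht, indicator_of_notMem, add_zero]
  simpa using ht.2

lemma concat_of_gt {T : ℝ} {a z : ℝ → ExtState V Ξ H} {t : ℝ} (ht : T < t) :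
    concat T a z t = z (t - T) := by
  rw [concat, indicator_of_notMem fun h => absurd h.2 (not_le.2 ht), indicator_of_mem, zero_add]
  simpa using ht

end Concat

variable {V Ξ H : Type*} [NormedAddCommGroup V] [InnerProductSpace ℝ V]
  [NormedAddCommGroup Ξ] [InnerProductSpace ℝ Ξ] [NormedAddCommGroup H] [InnerProductSpace ℝ H]
  {j : V →L[ℝ] H} {S : H →L[ℝ] V} {A : H →ₗ.[ℝ] H}

/-- Every initial state can be steered to zero in unit time by a source term. -/
lemma exists_trajectory [CompleteSpace V] [CompleteSpace H] (hj : Function.Injective j)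
    (hS : ∀ x y, (x, y) ∈ A.graph → j (S y) = x) {Gα : ℝ → V →L[ℝ] V} (hGα : IsC0Semigroup Gα)
    (hAα : IsGeneratorGraph (partGraph j A) Gα) :
    ∃ c : ℝ, ∀ x, ∃ z ∈ trajectories Ξ j S x, ∫ t in Ioi (0 : ℝ), ‖z t‖ ^ 2 ≤ c * ‖x‖ ^ 2 := by
  obtain ⟨M, hM0, hM⟩ := hGα.exists_bound 1
  refine ⟨(1 + ‖j‖ ^ 2) * M ^ 2, fun x => ?_⟩
  set g : ℝ → V := fun t => Gα (max t 0) x with hg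
  have hgc : Continuous g := hGα.continuous_orbit x
  have hSα : ∀ x y, (x, y) ∈ partGraph j A → (S ∘L j) y = x := fun x y h => hj (hS _ _ h)
  set w : ℝ → V := fun t => S (j x) + ∫ s in (0 : ℝ)..t, g s with hw
  have hwc : Continuous w :=
    continuous_const.add (intervalIntegral.continuous_primitive
      (fun a b => hgc.intervalIntegrable a b) 0)
  have hSg : ∀ t, 0 ≤ t → S (j (g t)) = w t := by
    intro t ht
    have := hGα.inverse_apply hAα hSα ht x
    simp only [ContinuousLinearMap.comp_apply] at this
    simp only [hg, hw, max_eq_left ht]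
    rw [this]
    congr 1
    refine intervalIntegral.integral_congr fun s hs => ?_
    rw [uIcc_of_le ht] at hs
    simp only [max_eq_left hs.1]
  -- Formally `((1 - t) g)' = A ((1 - t) g) - g`, which dictates the source `-g`. The state vanishes
  -- at `t = 1`, so extension by zero is again a trajectory.
  set a : ℝ → ExtState V Ξ H := fun t => ofProd V Ξ H ((1 - t) • g t, 0, -j (g t)) with ha
  have hac : Continuous a := by
    have : Continuous fun t : ℝ => (((1 - t) • g t, 0, -j (g t)) : V × Ξ × H) := by fun_prop
    exact (ofProd V Ξ H).continuous.comp this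
  have hDa : ∀ s, rightOp Ξ j S (a s) = j ((1 - s) • g s - S (j (g s))) := fun s => by
    simp [rightOp, ha, sub_eq_add_neg]
  have hCa : ∀ s, leftOp Ξ j S (a s) = (1 - s) • j (S (j (g s))) := fun s => by
    simp [leftOp, ha]
  have hint : ∀ t, 0 ≤ t → leftOp Ξ j S (a t) =
      j (S (j x)) + ∫ s in (0 : ℝ)..t, rightOp Ξ j S (a s) := by
    intro t ht
    -- The orbit `g` itself need not be differentiable, but `w = A⁻¹ g` is, with derivative `g`.
    have hder : ∀ s : ℝ, HasDerivAt (fun s : ℝ => (1 - s) • w s) ((1 - s) • g s - w s) s := by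
      intro s
      have h1 : HasDerivAt w (g s) s :=
        (hgc.integral_hasStrictDerivAt 0 s).hasDerivAt.const_add _
      have h2 : HasDerivAt (fun s : ℝ => 1 - s) (-1) s := by
        simpa using (hasDerivAt_id s).const_sub 1
      convert! h2.smul h1 using 1
      simp [sub_eq_add_neg]
    have hftc := intervalIntegral.integral_eq_sub_of_hasDerivAt (a := 0) (b := t)
      (fun s _ => hder s) (Continuous.intervalIntegrable (by fun_prop) _ _)
    have hw0 : w 0 = S (j x) := by simp [hw]
    have e : ∫ s in (0 : ℝ)..t, rightOp Ξ j S (a s) =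
        j (∫ s in (0 : ℝ)..t, ((1 - s) • g s - w s)) := by
      rw [← j.intervalIntegral_comp_comm (Continuous.intervalIntegrable (by fun_prop) _ _)]
      refine intervalIntegral.integral_congr fun s hs => ?_
      rw [uIcc_of_le ht] at hs
      simp only [hDa, hSg s hs.1]
    rw [e, hftc, hCa, hSg t ht, hw0]
    simp
  have hmem : MemLp ((Icc (0 : ℝ) 1).indicator a) 2 := by
    rw [memLp_indicator_iff_restrict measurableSet_Icc]
    exact (memLp_two_iff_integrable_sq_norm hac.aestronglyMeasurable).2
      ((by fun_prop : Continuous fun t => ‖a t‖ ^ 2).continuousOn.integrableOn_compact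
        isCompact_Icc)
  refine ⟨(Icc (0 : ℝ) 1).indicator a, ⟨hmem.mono_measure Measure.restrict_le_self, ?_⟩, ?_⟩
  · have hle : ∀ t, 0 ≤ t → t ≤ 1 → leftOp Ξ j S ((Icc (0 : ℝ) 1).indicator a t) = j (S (j x)) +
        ∫ s in (0 : ℝ)..t, rightOp Ξ j S ((Icc (0 : ℝ) 1).indicator a s) := by
      intro t ht ht1
      rw [indicator_of_mem (mem_Icc.2 ⟨ht, ht1⟩), hint t ht]
      congr 1
      refine intervalIntegral.integral_congr fun s hs => ?_
      rw [uIcc_of_le ht] at hs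
      simp only [indicator_of_mem (mem_Icc.2 ⟨hs.1, hs.2.trans ht1⟩)]
    intro t ht
    rcases le_or_gt t 1 with ht1 | ht1
    · exact hle t ht ht1
    · have hmem' := hmem.mono_measure (Measure.restrict_le_self (s := Ioi (0 : ℝ)))
      have i0 := intervalIntegrable_clm_of_memLp (rightOp Ξ j S) hmem' zero_le_one
      have it := intervalIntegrable_clm_of_memLp (rightOp Ξ j S) hmem' ht
      have hz : ∫ s in (1 : ℝ)..t, rightOp Ξ j S ((Icc (0 : ℝ) 1).indicator a s) = 0 := by
        rw [intervalIntegral.integral_of_le ht1.le]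
        refine setIntegral_eq_zero_of_forall_eq_zero fun s hs => ?_
        rw [indicator_of_notMem fun h => absurd h.2 (not_le.2 hs.1), map_zero]
      rw [← intervalIntegral.integral_add_adjacent_intervals i0 (i0.symm.trans it), hz, add_zero,
        ← hle 1 zero_le_one le_rfl, indicator_of_notMem fun h => absurd h.2 (not_le.2 ht1),
        indicator_of_mem (right_mem_Icc.2 zero_le_one), hCa]
      simp
  · have hb : ∀ t ∈ Icc (0 : ℝ) 1, ‖a t‖ ^ 2 ≤ (1 + ‖j‖ ^ 2) * M ^ 2 * ‖x‖ ^ 2 := by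
      intro t ht
      have h1 : ‖g t‖ ≤ M * ‖x‖ := by
        simp only [hg, max_eq_left ht.1]
        exact (Gα t).le_of_opNorm_le (hM t ht) x
      have h2 : ‖(1 - t) • g t‖ ≤ ‖g t‖ := by
        rw [norm_smul, Real.norm_of_nonneg (by linarith [ht.2])]
        exact mul_le_of_le_one_left (norm_nonneg _) (by linarith [ht.1])
      have h3 : ‖j (g t)‖ ≤ ‖j‖ * ‖g t‖ := j.le_opNorm _
      rw [norm_sq]
      simp only [ha, state_ofProd, control_ofProd, source_ofProd, norm_neg, norm_zero]
      calc ‖(1 - t) • g t‖ ^ 2 + 0 ^ 2 + ‖j (g t)‖ ^ 2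
          ≤ ‖g t‖ ^ 2 + 0 ^ 2 + (‖j‖ * ‖g t‖) ^ 2 := by gcongr
        _ = (1 + ‖j‖ ^ 2) * ‖g t‖ ^ 2 := by ring
        _ ≤ (1 + ‖j‖ ^ 2) * (M * ‖x‖) ^ 2 := by gcongr
        _ = _ := by ring
    have e : ∀ t, ‖(Icc (0 : ℝ) 1).indicator a t‖ ^ 2 =
        (Icc (0 : ℝ) 1).indicator (fun t => ‖a t‖ ^ 2) t := fun t => by
      by_cases ht : t ∈ Icc (0 : ℝ) 1
      · simp only [indicator_of_mem ht]
      · simp only [indicator_of_notMem ht, norm_zero]; norm_num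
    have hai : IntegrableOn (fun t => ‖a t‖ ^ 2) (Icc 0 1) :=
      (by fun_prop : Continuous fun t => ‖a t‖ ^ 2).continuousOn.integrableOn_compact isCompact_Icc
    calc ∫ t in Ioi (0 : ℝ), ‖(Icc (0 : ℝ) 1).indicator a t‖ ^ 2
        ≤ ∫ t, ‖(Icc (0 : ℝ) 1).indicator a t‖ ^ 2 :=
          setIntegral_le_integral (hmem.integrable_norm_pow two_ne_zero)
            (ae_of_all _ fun t => by positivity)
      _ = ∫ t in Icc (0 : ℝ) 1, ‖a t‖ ^ 2 := by
          rw [integral_congr_ae (ae_of_all _ e), integral_indicator measurableSet_Icc]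
      _ ≤ ∫ t in Icc (0 : ℝ) 1, (1 + ‖j‖ ^ 2) * M ^ 2 * ‖x‖ ^ 2 :=
          setIntegral_mono_on hai continuous_const.integrableOn_Icc measurableSet_Icc hb
      _ = (1 + ‖j‖ ^ 2) * M ^ 2 * ‖x‖ ^ 2 := by simp

/-- The integral is split at `T`: by `hy`, the integrated equation for `a` at `T` supplies exactly
the initial term of the equation for `z`. Only the state of `a` at `T` is matched with `y`; control
and source may jump there. -/
lemma concat_mem_trajectories {T : ℝ} (hT : 0 ≤ T) {a z : ℝ → ExtState V Ξ H} {x y : V}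
    (ha : MemLp a 2 (volume.restrict (Icc 0 T)))
    (hat : ∀ t ∈ Icc 0 T, leftOp Ξ j S (a t) =
      j (S (j x)) + ∫ s in (0 : ℝ)..t, rightOp Ξ j S (a s))
    (hy : leftOp Ξ j S (a T) = j (S (j y))) (hz : z ∈ trajectories Ξ j S y) :
    concat T a z ∈ trajectories Ξ j S x := by
  have hmem : MemLp (concat T a z) 2 := by
    refine MemLp.add ((memLp_indicator_iff_restrict measurableSet_Icc).2 ha) ?_
    exact ((memLp_indicator_iff_restrict measurableSet_Ioi).2 hz.1).comp_measurePreserving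
      (measurePreserving_sub_right volume T)
  have hmem' := hmem.mono_measure (Measure.restrict_le_self (s := Ioi (0 : ℝ)))
  have hle : ∀ t ∈ Icc 0 T, ∫ s in (0 : ℝ)..t, rightOp Ξ j S (concat T a z s) =
      ∫ s in (0 : ℝ)..t, rightOp Ξ j S (a s) := by
    intro t ht
    refine intervalIntegral.integral_congr fun s hs => ?_
    rw [uIcc_of_le ht.1] at hs
    simp only [concat_of_le (⟨hs.1, hs.2.trans ht.2⟩ : s ∈ Icc 0 T)]
  refine ⟨hmem', fun t ht => ?_⟩
  rcases le_or_gt t T with htT | htT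
  · rw [concat_of_le ⟨ht, htT⟩, hle t ⟨ht, htT⟩, hat t ⟨ht, htT⟩]
  · have i0 := intervalIntegrable_clm_of_memLp (rightOp Ξ j S) hmem' hT
    have it := intervalIntegrable_clm_of_memLp (rightOp Ξ j S) hmem' ht
    have e : ∫ s in T..t, rightOp Ξ j S (concat T a z s) =
        ∫ s in (0 : ℝ)..t - T, rightOp Ξ j S (z s) := by
      rw [← sub_self T, ← intervalIntegral.integral_comp_sub_right
        (fun s => rightOp Ξ j S (z s)) T]
      refine intervalIntegral.integral_congr_ae (ae_of_all _ fun s hs => ?_)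
      rw [uIoc_of_le htT.le] at hs
      rw [concat_of_gt hs.1]
    rw [← intervalIntegral.integral_add_adjacent_intervals i0 (i0.symm.trans it), e,
      hle T ⟨hT, le_rfl⟩, concat_of_gt htT, hz.2 _ (sub_nonneg.2 htT.le), ← hy,
      hat T ⟨hT, le_rfl⟩, add_assoc]

lemma integral_concat (Q : ExtState V Ξ H →L[ℝ] ExtState V Ξ H) {T : ℝ} (hT : 0 ≤ T)
    {a z : ℝ → ExtState V Ξ H} (ha : MemLp a 2 (volume.restrict (Icc 0 T)))
    (hz : MemLp z 2 (volume.restrict (Ioi 0))) :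
    ∫ t in Ioi (0 : ℝ), inner ℝ (Q (concat T a z t)) (concat T a z t) =
      (∫ t in (0 : ℝ)..T, inner ℝ (Q (a t)) (a t)) +
        ∫ t in Ioi (0 : ℝ), inner ℝ (Q (z t)) (z t) := by
  set q : ExtState V Ξ H → ℝ := fun z => inner ℝ (Q z) z with hq
  have hpt : ∀ t, q (concat T a z t) =
      (Icc 0 T).indicator (fun t => q (a t)) t + (Ioi 0).indicator (fun t => q (z t)) (t - T) := by
    intro t
    rcases le_or_gt t T with ht | ht
    · have h2 : t - T ∉ Ioi (0 : ℝ) := by simpa using ht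
      by_cases h1 : t ∈ Icc 0 T
      · rw [concat_of_le h1, indicator_of_mem h1, indicator_of_notMem h2, add_zero]
      · simp [concat, indicator_of_notMem h1, indicator_of_notMem h2, hq]
    · have h2 : t - T ∈ Ioi (0 : ℝ) := by simpa using ht
      rw [concat_of_gt ht, indicator_of_notMem fun h => absurd h.2 (not_le.2 ht),
        indicator_of_mem h2, zero_add]
  have hcompl : ∀ t ∉ Ici (0 : ℝ), q (concat T a z t) = 0 := by
    intro t ht
    have ht' : t < 0 := by simpa using ht
    rw [hpt, indicator_of_notMem fun h => absurd h.1 (not_le.2 ht'), indicator_of_notMem, add_zero]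
    simp only [mem_Ioi, not_lt]; linarith
  have i1 : Integrable ((Icc 0 T).indicator fun t => q (a t)) :=
    (integrable_indicator_iff measurableSet_Icc).2 (integrable_inner_clm Q ha)
  have i2 : Integrable ((Ioi (0 : ℝ)).indicator fun t => q (z t)) :=
    (integrable_indicator_iff measurableSet_Ioi).2 (integrable_inner_clm Q hz)
  change ∫ t in Ioi (0 : ℝ), q (concat T a z t) = _
  rw [← integral_Ici_eq_integral_Ioi, setIntegral_eq_integral_of_forall_compl_eq_zero hcompl]
  simp only [hpt]
  rw [integral_add i1 (i2.comp_sub_right T), integral_sub_right_eq_self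
    ((Ioi (0 : ℝ)).indicator fun t => q (z t)) T, integral_indicator measurableSet_Icc,
    integral_indicator measurableSet_Ioi, integral_Icc_eq_integral_Ioc,
    intervalIntegral.integral_of_le hT]

end ExtState

/-! ### From the frequency inequality to the Lyapunov inequality -/

section Existence

variable {V Ξ H : Type*} [NormedAddCommGroup V] [InnerProductSpace ℝ V]
  [NormedAddCommGroup Ξ] [InnerProductSpace ℝ Ξ] [NormedAddCommGroup H] [InnerProductSpace ℝ H]

lemma memLp_of_continuousOn_Icc {F : Type*} [NormedAddCommGroup F] {v : ℝ → F} {T : ℝ}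
    (hv : ContinuousOn v (Icc 0 T)) : MemLp v 2 (volume.restrict (Icc 0 T)) :=
  (memLp_two_iff_integrable_sq_norm (hv.aestronglyMeasurable measurableSet_Icc)).2
    ((hv.norm.pow 2).integrableOn_compact isCompact_Icc)

lemma intervalIntegrable_of_integrable_Icc {F : Type*} [NormedAddCommGroup F] {f : ℝ → F} {T : ℝ}
    (hT : 0 ≤ T) (hf : Integrable f (volume.restrict (Icc 0 T))) :
    IntervalIntegrable f volume 0 T :=
  (intervalIntegrable_iff_integrableOn_Icc_of_le hT).2 hf

lemma intervalIntegrable_quadForm (F₁ : V →L[ℝ] V) (F₂ : V →L[ℝ] Ξ) (F₃ : Ξ →L[ℝ] Ξ) {T : ℝ}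
    (hT : 0 ≤ T) {v : ℝ → V} {ξ : ℝ → Ξ} (hv : ContinuousOn v (Icc 0 T))
    (hξ : MemLp ξ 2 (volume.restrict (Icc 0 T))) :
    IntervalIntegrable (fun s => quadForm F₁ F₂ F₃ (v s) (ξ s)) volume 0 T := by
  have hv' := memLp_of_continuousOn_Icc hv
  refine intervalIntegrable_of_integrable_Icc hT ?_
  exact ((integrable_inner_of_memLp_two (𝕜 := ℝ) (F₁.comp_memLp' hv') hv').add
    ((integrable_inner_of_memLp_two (𝕜 := ℝ) (F₂.comp_memLp' hv') hξ).const_mul 2)).add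
    (integrable_inner_of_memLp_two (𝕜 := ℝ) (F₃.comp_memLp' hξ) hξ)

lemma intervalIntegrable_norm_sq_add {V Ξ : Type*} [NormedAddCommGroup V]
    [NormedAddCommGroup Ξ] {T : ℝ} (hT : 0 ≤ T) {v : ℝ → V} {ξ : ℝ → Ξ}
    (hv : ContinuousOn v (Icc 0 T)) (hξ : MemLp ξ 2 (volume.restrict (Icc 0 T))) :
    IntervalIntegrable (fun s => ‖v s‖ ^ 2 + ‖ξ s‖ ^ 2) volume 0 T :=
  intervalIntegrable_of_integrable_Icc hT
    (((memLp_of_continuousOn_Icc hv).integrable_norm_pow two_ne_zero).add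
      (hξ.integrable_norm_pow two_ne_zero))

lemma intervalIntegrable_clm_of_memLp_Icc (B : Ξ →L[ℝ] H) {ξ : ℝ → Ξ} {T t : ℝ}
    (hξ : MemLp ξ 2 (volume.restrict (Icc 0 T))) (ht : t ∈ Icc 0 T) :
    IntervalIntegrable (fun s => B (ξ s)) volume 0 t :=
  intervalIntegrable_of_integrable_Icc ht.1
    ((B.comp_memLp' (hξ.mono_measure (Measure.restrict_mono (Icc_subset_Icc_right ht.2)
      le_rfl))).integrable (by norm_num))

variable [CompleteSpace V] [CompleteSpace Ξ] [CompleteSpace H]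

open ExtState in
/-- The frequency inequality yields a bounded self-adjoint solution of the Lyapunov inequality. -/
theorem exists_lyapunov_of_frequency {j : V →L[ℝ] H} (hj : Function.Injective j)
    {A : H →ₗ.[ℝ] H} {G : ℝ → H →L[ℝ] H} (hG : IsC0Semigroup G)
    (hA : IsGeneratorGraph A.graph G)
    (hAα : ∃ Gα : ℝ → V →L[ℝ] V, IsC0Semigroup Gα ∧ IsGeneratorGraph (partGraph j A) Gα)
    (hRES : RES (complexify j) (complexifyPMap A)) (B : Ξ →L[ℝ] H)
    (F₁ : V →L[ℝ] V) (F₂ : V →L[ℝ] Ξ) (F₃ : Ξ →L[ℝ] Ξ)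
    (hF : FrequencyInequality (complexify j) (complexifyPMap A) (complexify B)
      (hermExt (quadForm F₁ F₂ F₃))) :
    ∃ (δ : ℝ) (P : V →L[ℝ] V), 0 < δ ∧ IsSelfAdjoint P ∧
      LyapunovInequality j G B (quadForm F₁ F₂ F₃) P δ := by
  obtain ⟨S, hS₁, hS₂⟩ := hRES.exists_inverse
  obtain ⟨Gα, hGα, hAα⟩ := hAα
  obtain ⟨N, δ, hδ, hfreq⟩ := exists_extended_frequency_inequality F₁ F₂ F₃ hj hRES B hF
  obtain ⟨c, hlift⟩ := exists_trajectory (Ξ := Ξ) hj hS₂ hGα hAα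
  obtain ⟨P, hP, hlub⟩ := exists_value_operator (costOp F₁ F₂ F₃ B N δ) (trajectories Ξ j S)
    (fun x z hz => hz.1) (fun x y z hz w hw => add_mem_trajectories hz hw)
    (fun r x z hz => smul_mem_trajectories r hz) hlift hδ
    (fun z hz => coercive_of_frequency F₁ F₂ F₃ B N δ hS₁ hRES.1 hfreq hδ.le hz)
  refine ⟨δ, P, hδ, hP, fun T hT v₀ ξ v hξ hmild => ?_⟩
  obtain ⟨-, hvc, hmild⟩ := hmild
  -- With source `B ξ` the penalty vanishes, and the cost is `F(v, ξ) + δ (|v|² + |ξ|²)`.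
  set a : ℝ → ExtState V Ξ H := fun t => ofProd V Ξ H (v t, ξ t, B (ξ t)) with ha
  have hBξ : MemLp (fun t => B (ξ t)) 2 (volume.restrict (Icc 0 T)) := B.comp_memLp' hξ
  have ham : MemLp a 2 (volume.restrict (Icc 0 T)) :=
    memLp_ofProd (memLp_of_continuousOn_Icc hvc) hξ hBξ
  have hat : ∀ t ∈ Icc 0 T, leftOp Ξ j S (a t) =
      j (S (j v₀)) + ∫ s in (0 : ℝ)..t, rightOp Ξ j S (a s) := by
    intro t ht
    have := hG.inverse_mild hA (R := j ∘L S) hS₂ ht.1 (j v₀)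
      (intervalIntegrable_clm_of_memLp_Icc B hξ ht)
    rw [← hmild t ht] at this
    simp only [ContinuousLinearMap.comp_apply] at this
    simp only [leftOp, rightOp, ha, ContinuousLinearMap.comp_apply, add_apply,
      state_ofProd, source_ofProd]
    rw [this]
    congr 1
    refine intervalIntegral.integral_congr fun s hs => ?_
    rw [uIcc_of_le ht.1] at hs
    rw [hmild s ⟨hs.1, hs.2.trans ht.2⟩]
  -- Dynamic programming: `a` followed by any continuation `z` competes in the supremum at `v₀`.
  -- Taking the supremum over `z` then produces `(P v(T), v(T))`.
  have hkey : ∀ z ∈ trajectories Ξ j S (v T),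
      ∫ t in Ioi (0 : ℝ), inner ℝ (costOp F₁ F₂ F₃ B N δ (z t)) (z t) ≤
        inner ℝ (P v₀) v₀ - ∫ t in (0 : ℝ)..T, inner ℝ (costOp F₁ F₂ F₃ B N δ (a t)) (a t) := by
    intro z hz
    have h1 := (hlub v₀).1 ⟨_, concat_mem_trajectories hT ham hat (by simp [leftOp, ha]) hz, rfl⟩
    simp only at h1
    rw [integral_concat _ hT ham hz.1] at h1
    linarith
  have hfin := (hlub (v T)).2 (by rintro _ ⟨z, hz, rfl⟩; exact hkey z hz)
  have hcost : ∀ t, inner ℝ (costOp F₁ F₂ F₃ B N δ (a t)) (a t) =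
      quadForm F₁ F₂ F₃ (v t) (ξ t) + δ * (‖v t‖ ^ 2 + ‖ξ t‖ ^ 2) := fun t => by
    rw [inner_costOp]
    simp [ha]
  simp only [hcost] at hfin
  rw [intervalIntegral.integral_add (intervalIntegrable_quadForm F₁ F₂ F₃ hT hvc hξ)
    ((intervalIntegrable_norm_sq_add hT hvc hξ).const_mul δ),
    intervalIntegral.integral_const_mul] at hfin
  simp only [RCLike.re_to_real]
  linarith

end Existence

/-! ### Classical solutions and the necessity of the frequency inequality -/

/-- Classical solutions of `u' = A u + f` are mild solutions. -/
lemma IsC0Semigroup.mild_of_classical {E : Type*} [NormedAddCommGroup E] [NormedSpace ℝ E]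
    [CompleteSpace E] {G : ℝ → E →L[ℝ] E} (hG : IsC0Semigroup G) {Γ : Submodule ℝ (E × E)}
    (hΓ : IsGeneratorGraph Γ G) {u y f : ℝ → E} (huy : ∀ s, (u s, y s) ∈ Γ)
    (hu : ∀ s, HasDerivAt u (y s + f s) s) (hf : Continuous f) {t : ℝ} (ht : 0 ≤ t) :
    u t = G t (u 0) + ∫ s in (0 : ℝ)..t, G (t - s) (f s) := by
  have huc : Continuous u := continuous_iff_continuousAt.2 fun s => (hu s).continuousAt
  set φ : ℝ → E := fun s => G (max (t - s) 0) (u s) with hφ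
  have hφc : Continuous φ :=
    hG.continuous_uncurry.comp (by fun_prop : Continuous fun s : ℝ => (t - s, u s))
  have hφ' : Continuous fun s : ℝ => G (max (t - s) 0) (f s) :=
    hG.continuous_uncurry.comp (by fun_prop : Continuous fun s : ℝ => (t - s, f s))
  -- Differentiating `G(t - s) u(s)` cancels the generator terms. Only right derivatives are taken:
  -- for `r > s` one factors `G(t - s) = G(t - r) G(r - s)` and uses the generator limit from the
  -- right.
  have hder : ∀ s ∈ Ioo 0 t, HasDerivWithinAt φ (G (max (t - s) 0) (f s)) (Ioi s) s := by
    intro s hs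
    rw [hasDerivWithinAt_iff_tendsto_slope' (by simp)]
    have hshift : Tendsto (fun r : ℝ => r - s) (𝓝[>] s) (𝓝[>] 0) := by
      refine tendsto_nhdsWithin_iff.2 ⟨?_, ?_⟩
      · have : Tendsto (fun r : ℝ => r - s) (𝓝 s) (𝓝 0) := by
          simpa using (by fun_prop : Continuous fun r : ℝ => r - s).tendsto s
        exact this.mono_left nhdsWithin_le_nhds
      · filter_upwards [self_mem_nhdsWithin] with r hr
        exact sub_pos.2 (mem_Ioi.1 hr)
    have h1 : Tendsto (fun r => (r - s)⁻¹ • (G (r - s) (u s) - u s)) (𝓝[>] s) (𝓝 (y s)) :=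
      ((hΓ _ _).1 (huy s)).comp hshift
    have h2 : Tendsto (slope u s) (𝓝[>] s) (𝓝 (y s + f s)) :=
      (hasDerivWithinAt_iff_tendsto_slope' (by simp)).1 (hu s).hasDerivWithinAt
    have h3 : Tendsto (fun r => slope u s r - (r - s)⁻¹ • (G (r - s) (u s) - u s)) (𝓝[>] s)
        (𝓝 (f s)) := by
      simpa using h2.sub h1
    have h4 : Tendsto (fun r : ℝ => t - r) (𝓝[>] s) (𝓝 (t - s)) :=
      ((by fun_prop : Continuous fun r : ℝ => t - r).tendsto s).mono_left nhdsWithin_le_nhds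
    refine ((hG.continuous_uncurry.tendsto (t - s, f s)).comp (h4.prodMk_nhds h3)).congr' ?_
    filter_upwards [Ioo_mem_nhdsGT hs.2] with r hr
    have hr1 : 0 ≤ r - s := sub_nonneg.2 hr.1.le
    have hr2 : 0 ≤ t - r := sub_nonneg.2 hr.2.le
    have e : G (t - s) (u s) = G (t - r) (G (r - s) (u s)) := by
      rw [← ContinuousLinearMap.comp_apply, ← hG.map_add _ _ hr2 hr1]
      congr 2
      ring
    simp only [Function.comp_apply, hφ, slope, vsub_eq_sub]
    rw [max_eq_left hr2, max_eq_left (sub_nonneg.2 hs.2.le), e]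
    simp only [map_sub, map_smul, smul_sub]
    abel
  have hftc := intervalIntegral.integral_eq_sub_of_hasDeriv_right_of_le ht hφc.continuousOn hder
    (hφ'.intervalIntegrable _ _)
  have e1 : ∫ s in (0 : ℝ)..t, G (t - s) (f s) = ∫ s in (0 : ℝ)..t, G (max (t - s) 0) (f s) := by
    refine intervalIntegral.integral_congr fun s hs => ?_
    rw [uIcc_of_le ht] at hs
    simp only [max_eq_left (sub_nonneg.2 hs.2)]
  rw [e1, hftc]
  simp [hφ, max_eq_left ht, hG.map_zero]

section Necessity

variable {V Ξ H : Type*} [NormedAddCommGroup V] [InnerProductSpace ℝ V]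
  [NormedAddCommGroup Ξ] [InnerProductSpace ℝ Ξ] [NormedAddCommGroup H] [InnerProductSpace ℝ H]

lemma hermExt_quadForm_smul (F₁ : V →L[ℝ] V) (F₂ : V →L[ℝ] Ξ) (F₃ : Ξ →L[ℝ] Ξ) (c : ℂ)
    (v : Cx V) (ξ : Cx Ξ) : hermExt (quadForm F₁ F₂ F₃) (c • v) (c • ξ) =
      ‖c‖ ^ 2 * hermExt (quadForm F₁ F₂ F₃) v ξ := by
  rw [Complex.sq_norm, Complex.normSq_apply]
  simp only [hermExt, quadForm, Cx.re_smul, Cx.im_smul, map_add, map_sub, map_smul,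
    inner_add_left, inner_add_right, inner_sub_left, inner_sub_right, inner_smul_left,
    inner_smul_right, conj_trivial]
  ring

variable [CompleteSpace H] {j : V →L[ℝ] H} {A : H →ₗ.[ℝ] H} {G : ℝ → H →L[ℝ] H}
  {B : Ξ →L[ℝ] H}

lemma continuous_re_exp_smul {E : Type*} [NormedAddCommGroup E] [InnerProductSpace ℝ E] (ω : ℝ)
    (x : Cx E) : Continuous fun s : ℝ => (Complex.exp (ω * Complex.I * s) • x).re :=
  Cx.reL.continuous.comp (by fun_prop : Continuous fun s : ℝ => Complex.exp (ω * Complex.I * s) • x)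

lemma re_smul_neg_I_smul {E : Type*} [NormedAddCommGroup E] [InnerProductSpace ℝ E] (c : ℂ)
    (x : Cx E) : (c • -Complex.I • x).re = (c • x).im := by
  simp [add_comm]

lemma continuous_im_exp_smul {E : Type*} [NormedAddCommGroup E] [InnerProductSpace ℝ E] (ω : ℝ)
    (x : Cx E) : Continuous fun s : ℝ => (Complex.exp (ω * Complex.I * s) • x).im := by
  simpa only [re_smul_neg_I_smul] using continuous_re_exp_smul ω (-Complex.I • x)

/-- Real parts of harmonic oscillations are mild solutions. -/
lemma isMildSolution_re_exp (hG : IsC0Semigroup G) (hA : IsGeneratorGraph A.graph G) {ω : ℝ}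
    {v : Cx V} {ξ : Cx Ξ} {y : Cx H} (hre : (j v.re, y.re) ∈ A.graph)
    (him : (j v.im, y.im) ∈ A.graph)
    (hy : ((ω : ℂ) * Complex.I) • complexify j v = y + complexify B ξ) (T : ℝ) :
    IsMildSolution j G B T v.re (fun s => (Complex.exp (ω * Complex.I * s) • ξ).re)
      (fun s => (Complex.exp (ω * Complex.I * s) • v).re) := by
  refine ⟨by simp, (continuous_re_exp_smul ω v).continuousOn, fun t ht => ?_⟩
  have hgr : ∀ s : ℝ, (j (Complex.exp (ω * Complex.I * s) • v).re,
      (Complex.exp (ω * Complex.I * s) • y).re) ∈ A.graph := by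
    intro s
    have := A.graph.sub_mem (A.graph.smul_mem (Complex.exp (ω * Complex.I * s)).re hre)
      (A.graph.smul_mem (Complex.exp (ω * Complex.I * s)).im him)
    simpa using this
  have hder : ∀ s : ℝ, HasDerivAt (fun s : ℝ => j (Complex.exp (ω * Complex.I * s) • v).re)
      ((Complex.exp (ω * Complex.I * s) • y).re +
        B (Complex.exp (ω * Complex.I * s) • ξ).re) s := by
    intro s
    have h1 : HasDerivAt (fun s : ℝ => Complex.exp (ω * Complex.I * s))
        (Complex.exp (ω * Complex.I * s) * (ω * Complex.I)) s := by
      have h0 : HasDerivAt (fun s : ℝ => (ω : ℂ) * Complex.I * s) ((ω : ℂ) * Complex.I) s := by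
        simpa using (Complex.ofRealCLM.hasDerivAt (x := s)).const_mul ((ω : ℂ) * Complex.I)
      exact h0.cexp
    have h2 := (Cx.reL (E := H)).hasFDerivAt.comp_hasDerivAt s (h1.smul_const (complexify j v))
    refine (h2.congr_of_eventuallyEq (Eventually.of_forall fun r => ?_)).congr_deriv ?_
    · change (complexify j (Complex.exp (ω * Complex.I * r) • v)).re =
        (Complex.exp (ω * Complex.I * r) • complexify j v).re
      rw [map_smul]
    · rw [mul_smul, hy, smul_add, ← map_smul]
      rfl
  have h := hG.mild_of_classical hA hgr hder
    (B.continuous.comp (continuous_re_exp_smul ω ξ)) ht.1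
  simpa using h

/-- Over a full period of `exp(iωt) (v, ξ)` the terms with `P` cancel. Adding the inequalities for
the real and imaginary parts makes both integrands constant in time, since the Hermitian extension
and the norm are invariant under unimodular factors; dividing by the period leaves the pointwise
inequality. -/
theorem frequency_of_lyapunov (hG : IsC0Semigroup G) (hA : IsGeneratorGraph A.graph G)
    (hspec : ∀ ω : ℝ, (ω : ℂ) * Complex.I ∈ unboundedResolventSet (complexifyPMap A))
    {F₁ : V →L[ℝ] V} {F₂ : V →L[ℝ] Ξ} {F₃ : Ξ →L[ℝ] Ξ} {δ : ℝ} (hδ : 0 < δ) {P : V →L[ℝ] V}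
    (hP : LyapunovInequality j G B (quadForm F₁ F₂ F₃) P δ) :
    FrequencyInequality (complexify j) (complexifyPMap A) (complexify B)
      (hermExt (quadForm F₁ F₂ F₃)) := by
  refine ⟨δ, hδ, fun ω ξ v hv => ?_⟩
  obtain ⟨hd, he⟩ := (isResolventAt_unboundedResolvent (hspec ω)).1 (complexify B ξ)
  obtain ⟨hre, him⟩ := graph_of_complexifyPMap_eq hd rfl
  set y : Cx H := -(complexifyPMap A ⟨_, hd⟩) with hydef
  have hy : ((ω : ℂ) * Complex.I) • complexify j v = y + complexify B ξ := by
    rw [hv, hydef, smul_neg, eq_neg_add_iff_add_eq, ← sub_eq_add_neg, he]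
  have hre' : (j v.re, y.re) ∈ A.graph := by
    have h1 : j v.re = _ := congrArg Cx.re hv
    rw [h1, hydef, Cx.re_neg, Cx.re_neg, ← Prod.neg_mk]
    exact A.graph.neg_mem hre
  have him' : (j v.im, y.im) ∈ A.graph := by
    have h1 : j v.im = _ := congrArg Cx.im hv
    rw [h1, hydef, Cx.im_neg, Cx.im_neg, ← Prod.neg_mk]
    exact A.graph.neg_mem him
  obtain ⟨T, hT, hexp⟩ : ∃ T : ℝ, 0 < T ∧ Complex.exp (ω * Complex.I * T) = 1 := by
    rcases eq_or_ne ω 0 with rfl | hω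
    · exact ⟨1, one_pos, by simp⟩
    · have hωc : (ω : ℂ) ≠ 0 := by exact_mod_cast hω
      refine ⟨2 * Real.pi / |ω|, by positivity, ?_⟩
      rcases abs_choice ω with h | h
      · rw [h, ← Complex.exp_two_pi_mul_I]
        congr 1
        push_cast
        field_simp
      · rw [h, ← inv_inj, ← Complex.exp_neg, inv_one, ← Complex.exp_two_pi_mul_I]
        congr 1
        push_cast
        field_simp
  have key : ∀ (w : Cx V) (η : Cx Ξ) (x : Cx H), (j w.re, x.re) ∈ A.graph →
      (j w.im, x.im) ∈ A.graph →
      ((ω : ℂ) * Complex.I) • complexify j w = x + complexify B η →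
      ∫ s in (0 : ℝ)..T, quadForm F₁ F₂ F₃ (Complex.exp (ω * Complex.I * s) • w).re
        (Complex.exp (ω * Complex.I * s) • η).re ≤
      -δ * ∫ s in (0 : ℝ)..T, (‖(Complex.exp (ω * Complex.I * s) • w).re‖ ^ 2 +
        ‖(Complex.exp (ω * Complex.I * s) • η).re‖ ^ 2) := by
    intro w η x h1 h2 h3
    have := hP T hT.le _ _ _
      (memLp_of_continuousOn_Icc (continuous_re_exp_smul ω η).continuousOn)
      (isMildSolution_re_exp hG hA h1 h2 h3 T)
    rw [hexp, one_smul, sub_self, zero_add] at this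
    exact this
  have k1 := key v ξ y hre' him' hy
  -- Multiplication by `-i` turns imaginary parts into real parts, so `key` covers both.
  have k2 := key (-Complex.I • v) (-Complex.I • ξ) (-Complex.I • y) (by simpa using him')
    (by simpa using A.graph.neg_mem hre') (by rw [map_smul, map_smul, smul_comm, hy, smul_add])
  simp only [re_smul_neg_I_smul] at k2
  have cv := (continuous_re_exp_smul ω v).continuousOn (s := Icc 0 T)
  have cv' := (continuous_im_exp_smul ω v).continuousOn (s := Icc 0 T)
  have mξ := memLp_of_continuousOn_Icc (T := T) (continuous_re_exp_smul ω ξ).continuousOn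
  have mξ' := memLp_of_continuousOn_Icc (T := T) (continuous_im_exp_smul ω ξ).continuousOn
  have hsum := add_le_add k1 k2
  rw [← mul_add, ← intervalIntegral.integral_add
      (intervalIntegrable_quadForm F₁ F₂ F₃ hT.le cv mξ)
      (intervalIntegrable_quadForm F₁ F₂ F₃ hT.le cv' mξ'),
    ← intervalIntegral.integral_add (intervalIntegrable_norm_sq_add hT.le cv mξ)
      (intervalIntegrable_norm_sq_add hT.le cv' mξ')] at hsum
  have hn : ∀ s : ℝ, ‖Complex.exp (ω * Complex.I * s)‖ = 1 := fun s => by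
    rw [Complex.norm_exp]; simp
  have e1 : ∀ s : ℝ, quadForm F₁ F₂ F₃ (Complex.exp (ω * Complex.I * s) • v).re
        (Complex.exp (ω * Complex.I * s) • ξ).re +
      quadForm F₁ F₂ F₃ (Complex.exp (ω * Complex.I * s) • v).im
        (Complex.exp (ω * Complex.I * s) • ξ).im = hermExt (quadForm F₁ F₂ F₃) v ξ := fun s => by
    have := hermExt_quadForm_smul F₁ F₂ F₃ (Complex.exp (ω * Complex.I * s)) v ξ
    rwa [hn, one_pow, one_mul] at this
  have e2 : ∀ s : ℝ, ‖(Complex.exp (ω * Complex.I * s) • v).re‖ ^ 2 +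
        ‖(Complex.exp (ω * Complex.I * s) • ξ).re‖ ^ 2 +
      (‖(Complex.exp (ω * Complex.I * s) • v).im‖ ^ 2 +
        ‖(Complex.exp (ω * Complex.I * s) • ξ).im‖ ^ 2) = ‖v‖ ^ 2 + ‖ξ‖ ^ 2 := fun s => by
    rw [add_add_add_comm, ← Cx.norm_sq, ← Cx.norm_sq, norm_smul, norm_smul, hn, one_mul, one_mul]
  simp only [e1, e2, intervalIntegral.integral_const, sub_zero, smul_eq_mul] at hsum
  have hle : hermExt (quadForm F₁ F₂ F₃) v ξ ≤ -δ * (‖v‖ ^ 2 + ‖ξ‖ ^ 2) :=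
    le_of_mul_le_mul_left (by linarith) hT
  nlinarith [mul_nonneg hδ.le (sq_nonneg ‖v‖)]

end Necessity

/-! ### Passing between real and complex solutions of the Lyapunov inequality -/

section Complexification

variable {V Ξ H : Type*} [NormedAddCommGroup V] [InnerProductSpace ℝ V]
  [NormedAddCommGroup Ξ] [InnerProductSpace ℝ Ξ] [NormedAddCommGroup H] [InnerProductSpace ℝ H]

/-- The imaginary part as a bounded real-linear operator. -/
def Cx.imL : Cx H →L[ℝ] H :=
  Cx.reL ∘L ((-Complex.I) • ContinuousLinearMap.id ℂ (Cx H)).restrictScalars ℝ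

lemma Cx.imL_apply (z : Cx H) : Cx.imL z = z.im := by
  change ((-Complex.I) • z).re = z.im
  simp

lemma Cx.continuousOn_im {z : ℝ → Cx H} {s : Set ℝ} (hz : ContinuousOn z s) :
    ContinuousOn (fun t => (z t).im) s := by
  have h := Cx.imL.continuous.comp_continuousOn hz
  simp only [Function.comp_def, Cx.imL_apply] at h
  exact h

lemma Cx.memLp_im {z : ℝ → Cx H} {μ : Measure ℝ} (hz : MemLp z 2 μ) :
    MemLp (fun t => (z t).im) 2 μ := by
  have h := Cx.imL.comp_memLp' hz
  simp only [Function.comp_def, Cx.imL_apply] at h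
  exact h

lemma Cx.eq_add_smul (z : Cx H) : z = ofRealL z.re + Complex.I • ofRealL z.im := by
  ext <;> simp

lemma Cx.intervalIntegrable {z : ℝ → Cx H} {a b : ℝ}
    (hre : IntervalIntegrable (fun t => (z t).re) volume a b)
    (him : IntervalIntegrable (fun t => (z t).im) volume a b) :
    IntervalIntegrable z volume a b := by
  have h1 := intervalIntegrable_clm_comp Cx.ofRealL hre
  have h2 := (intervalIntegrable_clm_comp Cx.ofRealL him).smul Complex.I
  exact (h1.add h2).congr (fun t _ => (Cx.eq_add_smul (z t)).symm)

variable [CompleteSpace H] {j : V →L[ℝ] H} {G : ℝ → H →L[ℝ] H} {B : Ξ →L[ℝ] H}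
  {F₁ : V →L[ℝ] V} {F₂ : V →L[ℝ] Ξ} {F₃ : Ξ →L[ℝ] Ξ}

/-- A complex mild solution consists of two real mild solutions. -/
lemma IsMildSolution.re_im (hG : IsC0Semigroup G) {T : ℝ} {v₀ : Cx V} {ξ : ℝ → Cx Ξ}
    {v : ℝ → Cx V} (hξ : MemLp ξ 2 (volume.restrict (Icc 0 T)))
    (h : IsMildSolution (complexify j) (fun t => complexify (G t)) (complexify B) T v₀ ξ v) :
    IsMildSolution j G B T v₀.re (fun t => (ξ t).re) (fun t => (v t).re) ∧
      IsMildSolution j G B T v₀.im (fun t => (ξ t).im) (fun t => (v t).im) := by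
  obtain ⟨h0, hc, h⟩ := h
  -- Integrability of the complex convolution, needed for real and imaginary parts to commute with
  -- the integral, is assembled from that of its two real components.
  have hint : ∀ t ∈ Icc 0 T, IntervalIntegrable
      (fun s => complexify (G (t - s)) (complexify B (ξ s))) volume 0 t := fun t ht =>
    Cx.intervalIntegrable
      (hG.intervalIntegrable_convolution ht.1
        (intervalIntegrable_clm_of_memLp_Icc B (Cx.reL.comp_memLp' hξ) ht))
      (hG.intervalIntegrable_convolution ht.1
        (intervalIntegrable_clm_of_memLp_Icc B (Cx.memLp_im hξ) ht))
  refine ⟨⟨congrArg Cx.re h0, Cx.reL.continuous.comp_continuousOn hc, fun t ht => ?_⟩,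
    ⟨congrArg Cx.im h0, Cx.continuousOn_im hc, fun t ht => ?_⟩⟩
  · have := congrArg Cx.reL (h t ht)
    rw [map_add, ← Cx.reL.intervalIntegral_comp_comm (hint t ht)] at this
    exact this
  · have := congrArg Cx.imL (h t ht)
    rw [map_add, ← Cx.imL.intervalIntegral_comp_comm (hint t ht)] at this
    simpa only [Cx.imL_apply] using! this

/-- Real mild solutions are complex mild solutions. -/
lemma IsMildSolution.ofReal (hG : IsC0Semigroup G) {T : ℝ} {v₀ : V} {ξ : ℝ → Ξ} {v : ℝ → V}
    (hξ : MemLp ξ 2 (volume.restrict (Icc 0 T))) (h : IsMildSolution j G B T v₀ ξ v) :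
    IsMildSolution (complexify j) (fun t => complexify (G t)) (complexify B) T
      (Cx.ofRealL v₀) (fun t => Cx.ofRealL (ξ t)) (fun t => Cx.ofRealL (v t)) := by
  obtain ⟨h0, hc, h⟩ := h
  refine ⟨congrArg _ h0, Cx.ofRealL.continuous.comp_continuousOn hc, fun t ht => ?_⟩
  simp only [complexify_ofRealL]
  rw [Cx.ofRealL.intervalIntegral_comp_comm (hG.intervalIntegrable_convolution ht.1
    (intervalIntegrable_clm_of_memLp_Icc B hξ ht)), ← map_add, h t ht]

lemma isSelfAdjoint_complexify [CompleteSpace V] {P : V →L[ℝ] V} (hP : IsSelfAdjoint P) :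
    IsSelfAdjoint (complexify P) := by
  rw [ContinuousLinearMap.isSelfAdjoint_iff_isSymmetric] at hP ⊢
  intro x y
  have h : ∀ a b, inner ℝ (P a) b = inner ℝ a (P b) := hP
  simp [Cx.inner_def, h]

lemma isSelfAdjoint_realBlock [CompleteSpace V] {P : Cx V →L[ℂ] Cx V} (hP : IsSelfAdjoint P) :
    IsSelfAdjoint (realBlock P) := by
  rw [ContinuousLinearMap.isSelfAdjoint_iff_isSymmetric] at hP ⊢
  intro x y
  have h := congrArg Complex.re (hP (Cx.ofRealL x) (Cx.ofRealL y))
  simp only [ContinuousLinearMap.coe_coe, Cx.inner_def, re_ofRealL, im_ofRealL, inner_zero_left,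
    inner_zero_right, add_zero] at h
  exact h

/-- Every term splits as a sum over real and imaginary parts, which are themselves real mild
solutions, so two real inequalities add up to the complex one. -/
theorem LyapunovInequality.complexify (hG : IsC0Semigroup G) {P : V →L[ℝ] V} {δ : ℝ}
    (hP : LyapunovInequality j G B (quadForm F₁ F₂ F₃) P δ) :
    LyapunovInequality (FreqThm.complexify j) (fun t => FreqThm.complexify (G t))
      (FreqThm.complexify B) (hermExt (quadForm F₁ F₂ F₃)) (FreqThm.complexify P) δ := by
  intro T hT v₀ ξ v hξ hv
  obtain ⟨h1, h2⟩ := hv.re_im hG hξ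
  have m1 : MemLp (fun t => (ξ t).re) 2 (volume.restrict (Icc 0 T)) := Cx.reL.comp_memLp' hξ
  have m2 := Cx.memLp_im hξ
  have k := add_le_add (hP T hT _ _ _ m1 h1) (hP T hT _ _ _ m2 h2)
  rw [← mul_add, ← intervalIntegral.integral_add (intervalIntegrable_norm_sq_add hT h1.2.1 m1)
    (intervalIntegrable_norm_sq_add hT h2.2.1 m2)] at k
  simp only [hermExt, Cx.norm_sq]
  rw [intervalIntegral.integral_add (intervalIntegrable_quadForm F₁ F₂ F₃ hT h1.2.1 m1)
    (intervalIntegrable_quadForm F₁ F₂ F₃ hT h2.2.1 m2)]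
  have e : ∀ s, ‖(v s).re‖ ^ 2 + ‖(v s).im‖ ^ 2 + (‖(ξ s).re‖ ^ 2 + ‖(ξ s).im‖ ^ 2) =
      ‖(v s).re‖ ^ 2 + ‖(ξ s).re‖ ^ 2 + (‖(v s).im‖ ^ 2 + ‖(ξ s).im‖ ^ 2) :=
    fun s => add_add_add_comm _ _ _ _
  simp only [e]
  simp only [RCLike.re_to_real, RCLike.re_to_complex, Cx.inner_def, re_complexify,
    im_complexify] at k ⊢
  linarith

/-- Real solutions are admissible in the complex system, and on real vectors `(P x, x)` has real
part `(P₁₁ x, x)`; the other blocks do not contribute. -/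
theorem LyapunovInequality.realBlock (hG : IsC0Semigroup G) {P : Cx V →L[ℂ] Cx V} {δ : ℝ}
    (hP : LyapunovInequality (FreqThm.complexify j) (fun t => FreqThm.complexify (G t))
      (FreqThm.complexify B) (hermExt (quadForm F₁ F₂ F₃)) P δ) :
    LyapunovInequality j G B (quadForm F₁ F₂ F₃) (FreqThm.realBlock P) δ := by
  intro T hT v₀ ξ v hξ hv
  have k := hP T hT _ _ _ (Cx.ofRealL.comp_memLp' hξ) (hv.ofReal hG hξ)
  have hq : ∀ (x : V) (η : Ξ), hermExt (quadForm F₁ F₂ F₃) (Cx.ofRealL x) (Cx.ofRealL η) =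
      quadForm F₁ F₂ F₃ x η := fun x η => by simp [hermExt, quadForm]
  have hi : ∀ x : V, RCLike.re (inner ℂ (P (Cx.ofRealL x)) (Cx.ofRealL x)) =
      inner ℝ (FreqThm.realBlock P x) x := fun x => by simp [Cx.inner_def]; rfl
  simp only [Function.comp_apply, hq, hi, norm_ofRealL] at k
  exact k

end Complexification

end FreqThm

end

theorem mainTheorem3
    {H Hα Ξ : Type*}
    [NormedAddCommGroup H] [InnerProductSpace ℝ H] [CompleteSpace H]
    [NormedAddCommGroup Hα] [InnerProductSpace ℝ Hα] [CompleteSpace Hα]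
    [NormedAddCommGroup Ξ] [InnerProductSpace ℝ Ξ] [CompleteSpace Ξ]
    -- the continuous dense embedding of `Hα` into `H`
    (j : Hα →L[ℝ] H) (hj_inj : Function.Injective j) (hj_dense : DenseRange j)
    -- `A` generates the `C₀`-semigroup `G` in `H`, and `D(A) ⊂ Hα`
    (A : H →ₗ.[ℝ] H) (G : ℝ → H →L[ℝ] H)
    (hG : FreqThm.IsC0Semigroup G) (hA : FreqThm.IsGeneratorGraph A.graph G)
    (hA_dom : ∀ x ∈ A.domain, x ∈ Set.range j)
    -- `A` (that is, its part in `Hα`) also generates a `C₀`-semigroup in `Hα`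
    (hAα : ∃ Gα : ℝ → Hα →L[ℝ] Hα,
      FreqThm.IsC0Semigroup Gα ∧ FreqThm.IsGeneratorGraph (FreqThm.partGraph j A) Gα)
    -- (RES) for the complexifications
    (hRES : FreqThm.RES (FreqThm.complexify j) (FreqThm.complexifyPMap A))
    (B : Ξ →L[ℝ] H)
    (F₁ : Hα →L[ℝ] Hα) (F₂ : Hα →L[ℝ] Ξ) (F₃ : Ξ →L[ℝ] Ξ)
    (hF₁ : IsSelfAdjoint F₁) (hF₃ : IsSelfAdjoint F₃) :
    -- the frequency inequality is equivalent to the existence of a real operator `P`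
    (FreqThm.FrequencyInequality (FreqThm.complexify j) (FreqThm.complexifyPMap A)
        (FreqThm.complexify B) (FreqThm.hermExt (FreqThm.quadForm F₁ F₂ F₃)) ↔
      ∃ (δ : ℝ) (P : Hα →L[ℝ] Hα), 0 < δ ∧ IsSelfAdjoint P ∧
        FreqThm.LyapunovInequality j G B (FreqThm.quadForm F₁ F₂ F₃) P δ) ∧
    -- under the frequency inequality there is an operator `P'` for the complexified system
    (FreqThm.FrequencyInequality (FreqThm.complexify j) (FreqThm.complexifyPMap A)
        (FreqThm.complexify B) (FreqThm.hermExt (FreqThm.quadForm F₁ F₂ F₃)) →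
      ∃ (δ : ℝ) (P' : FreqThm.Cx Hα →L[ℂ] FreqThm.Cx Hα), 0 < δ ∧ IsSelfAdjoint P' ∧
        FreqThm.LyapunovInequality (FreqThm.complexify j) (fun t => FreqThm.complexify (G t))
          (FreqThm.complexify B) (FreqThm.hermExt (FreqThm.quadForm F₁ F₂ F₃)) P' δ) ∧
    -- and the real block of any such `P'` is an operator as required in the real system
    (∀ (δ : ℝ) (P' : FreqThm.Cx Hα →L[ℂ] FreqThm.Cx Hα), 0 < δ → IsSelfAdjoint P' →
      FreqThm.LyapunovInequality (FreqThm.complexify j) (fun t => FreqThm.complexify (G t))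
        (FreqThm.complexify B) (FreqThm.hermExt (FreqThm.quadForm F₁ F₂ F₃)) P' δ →
      IsSelfAdjoint (FreqThm.realBlock P') ∧
        FreqThm.LyapunovInequality j G B (FreqThm.quadForm F₁ F₂ F₃)
          (FreqThm.realBlock P') δ) := by
  have hreal := FreqThm.exists_lyapunov_of_frequency hj_inj hG hA hAα hRES B F₁ F₂ F₃
  refine ⟨⟨hreal, ?_⟩, fun hF => ?_, fun δ P' _ hP' hL => ?_⟩
  · rintro ⟨δ, P, hδ, -, hL⟩
    exact FreqThm.frequency_of_lyapunov hG hA hRES.1 hδ hL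
  · obtain ⟨δ, P, hδ, hP, hL⟩ := hreal hF
    exact ⟨δ, FreqThm.complexify P, hδ, FreqThm.isSelfAdjoint_complexify hP, hL.complexify hG⟩
  · exact ⟨FreqThm.isSelfAdjoint_realBlock hP', hL.realBlock hG⟩
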